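/- Let $\mathcal M_0$ be a smooth finite-dimensional manifold without boundary, $g_0$ a smooth Riemannian metric, $\delta$ a smooth vector field and $\beta>0$ a smooth function on $\mathcal M_0$. The associated standard stationary spacetime is $\mathcal M=\mathcal M_0\times\mathbb R$ with the Lorentzian metric $$g(x,t)[(y,\tau),(y,\tau)]=g_0(x)[y,y]+2g_0(x)[\delta(x),y]\,\tau-\beta(x)\,\tau^2 ,$$ time-oriented by $\partial_t$. Put $\tilde g_0=g_0/\beta$, let $h(x)[y,y]=\tilde g_0(x)[\delta(x),y]^2+\tilde g_0(x)[y,y]$, and let $$F(x,y)=\tilde g_0(x)[\delta(x),y]+\sqrt{\tilde g_0(x)[\delta(x),y]^2+\tilde g_0(x)[y,y]}$$ be the Fermat metric on $\mathcal M_0$. A geodesic of $(\mathcal M,g/\beta)$ is a smooth curve $z$ with $\nabla_{\dot z}\dot z=0$ for the Levi-Civita connection of $g/\beta$; it is lightlike if $\dot z\neq0$ and $(g/\beta)[\dot z,\dot z]=0$ everywhere, and a curve $z$ is future-pointing if $(g/\beta)[\dot z,\partial_t]<0$ everywhere. A geodesic of the Finsler metric $F$ is a smooth curve $x$ with $\dot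 x\ne0$ everywhere and $D_{T}\bigl(T/F(x,T)\bigr)=0$, $T=\dot x$, where $D_T$ is the covariant derivative along $x$ defined by the Chern connection of $F$ with reference vector $T$. **Theorem (Fermat's principle).** Let $x_0,x_1\in\mathcal M_0$ and $t_0\in\mathbb R$, and let $z=(x,t):[0,1]\to\mathcal M$ be a curve that joins $(x_0,t_0)$ to the vertical line $\gamma(s)=(x_1,s)$, i.e. $x(0)=x_0$, $t(0)=t_0$, $x(1)=x_1$. Then $z$ is a future-pointing lightlike geodesic of $(\mathcal M,g/\beta)$ if and only if both of the following hold: 1. $x$ is a geodesic of the Fermat metric $F$ and $h(x)[\dot x,\dot x]$ is constant on $[0,1]$; 2. for all $s\in[0,1]$, $$t(s)=t_0+\int_0^s\Bigl(\tilde g_0(x)[\delta(x),\dot x]+\sqrt{\tilde g_0(x)[\delta(x),\dot x]^2+\tilde g_0(x)[\dot x,\dot x]}\Bigr)\,dv=t_0+\int_0^sF(x,\dot x)\,dv .$$ -/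

import Mathlib

set_option maxSynthPendingDepth 3

open Set Bundle
open scoped Manifold ContDiff

noncomputable section

namespace FermatPrinciple

/-! ## Velocities and chart representations

Manifolds have no boundary and are finite dimensional.  A curve is a map `γ : ℝ → M` of which only
the restriction to a parameter set `S` (an interval) matters: all derivatives in the parameter are
derivatives within `S`, so that they are one-sided at the end points of `S`. -/

section Charts

variable {E : Type*} [NormedAddCommGroup E] [NormedSpace ℝ E]
  {H : Type*} [TopologicalSpace H] (I : ModelWithCorners ℝ E H)
  {M : Type*} [TopologicalSpace M] [ChartedSpace H M]

/-- The velocity `γ̇(s)` of a curve with parameter set `S`. -/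
def velocity (γ : ℝ → M) (S : Set ℝ) (s : ℝ) : TangentSpace I (γ s) :=
  mfderivWithin 𝓘(ℝ, ℝ) I γ S s (1 : ℝ)

/-- The components `Dφ(q) v` of a tangent vector `v` at `q` in the preferred chart `φ` at `p`. -/
def chartVec (p q : M) (v : TangentSpace I q) : E :=
  mfderiv I 𝓘(ℝ, E) (extChartAt I p) q v

/-- The coordinate frame `Dφ⁻¹(a)` at the point with coordinates `a` in the preferred
chart `φ` at `p`; inverse to `chartVec`. -/
def chartFrame (p : M) (a : E) : E →L[ℝ] TangentSpace I ((extChartAt I p).symm a) :=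
  mfderivWithin 𝓘(ℝ, E) I (extChartAt I p).symm (range I) a

/-- A field of bilinear forms on the tangent spaces. -/
abbrev TwoTensor (M : Type*) [TopologicalSpace M] [ChartedSpace H M] :=
  ∀ p : M, TangentSpace I p →L[ℝ] TangentSpace I p →L[ℝ] ℝ

variable {I}

/-- The components of a bilinear tensor field in the preferred chart at `p`. -/
def TwoTensor.inChart (g : TwoTensor I M) (p : M) (a : E) : E →L[ℝ] E →L[ℝ] ℝ :=
  (ContinuousLinearMap.precomp ℝ (chartFrame I p a)).comp
    ((g ((extChartAt I p).symm a)).comp (chartFrame I p a))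

end Charts

/-! ## Christoffel symbols, Levi-Civita derivative along a curve, pseudo-Riemannian geodesics -/

section LeviCivita

variable {E : Type*} [NormedAddCommGroup E] [NormedSpace ℝ E]

/-- Christoffel symbols of the first kind, lowered index last:
`½ (∂_u g (v, w) + ∂_v g (u, w) - ∂_w g (u, v))`, where `dg u v w = ∂_u g (v, w)`. -/
def christoffelFirst (dg : E →L[ℝ] E →L[ℝ] E →L[ℝ] ℝ) : E →L[ℝ] E →L[ℝ] E →L[ℝ] ℝ :=
  (1 / 2 : ℝ) • (dg + dg.flip -
    (ContinuousLinearMap.flipₗᵢ ℝ E E ℝ : (E →L[ℝ] E →L[ℝ] ℝ) ≃ₗᵢ[ℝ] (E →L[ℝ] E →L[ℝ] ℝ)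
      ).toContinuousLinearEquiv.toContinuousLinearMap.comp dg.flip)

theorem christoffelFirst_apply (dg : E →L[ℝ] E →L[ℝ] E →L[ℝ] ℝ) (u v w : E) :
    christoffelFirst dg u v w = (1 / 2 : ℝ) * (dg u v w + dg v u w - dg w u v) := by
  simp [christoffelFirst]

/-- Christoffel symbols `γⁱⱼₖ uʲ vᵏ`: the last index is raised with the inverse of the
nondegenerate form `g : E → E*`. -/
def christoffel (g : E →L[ℝ] E →L[ℝ] ℝ) (dg : E →L[ℝ] E →L[ℝ] E →L[ℝ] ℝ) :
    E →L[ℝ] E →L[ℝ] E :=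
  (ContinuousLinearMap.postcomp E g.inverse).comp (christoffelFirst dg)

theorem christoffel_apply (g : E →L[ℝ] E →L[ℝ] ℝ) (dg : E →L[ℝ] E →L[ℝ] E →L[ℝ] ℝ) (u v : E) :
    christoffel g dg u v = g.inverse (christoffelFirst dg u v) := rfl

variable {H : Type*} [TopologicalSpace H] {I : ModelWithCorners ℝ E H}
  {M : Type*} [TopologicalSpace M] [ChartedSpace H M]

/-- The Christoffel symbols of the (pseudo-)Riemannian metric `g` in the preferred chart at `p`,
at the point with coordinates `a`. -/
def leviCivitaSymbol (g : TwoTensor I M) (p : M) (a : E) : E →L[ℝ] E →L[ℝ] E :=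
  christoffel (g.inChart p a) (fderiv ℝ (g.inChart p) a)

/-- The Levi-Civita covariant derivative `∇_γ W` at parameter `s` of a vector field `W` along `γ`,
computed in the preferred chart at `γ s`:
`(∇_γ W)ⁱ = dWⁱ/ds + Γⁱⱼₖ(γ) γ̇ʲ Wᵏ`. -/
def leviCivitaAlong (g : TwoTensor I M) (γ : ℝ → M) (S : Set ℝ)
    (W : ∀ s, TangentSpace I (γ s)) (s : ℝ) : E :=
  derivWithin (fun r => chartVec I (γ s) (γ r) (W r)) S s +
    leviCivitaSymbol g (γ s) (extChartAt I (γ s) (γ s))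
      (chartVec I (γ s) (γ s) (velocity I γ S s)) (chartVec I (γ s) (γ s) (W s))

/-- Geodesic of a (pseudo-)Riemannian metric: a smooth curve with `∇_γ γ̇ = 0`. -/
def IsGeodesicOn (g : TwoTensor I M) (γ : ℝ → M) (S : Set ℝ) : Prop :=
  ContMDiffOn 𝓘(ℝ, ℝ) I ∞ γ S ∧
    ∀ s ∈ S, leviCivitaAlong g γ S (velocity I γ S) s = 0

/-- Geodesic with lightlike velocity (nonzero and of vanishing square). -/
def IsLightlikeGeodesicOn (g : TwoTensor I M) (γ : ℝ → M) (S : Set ℝ) : Prop :=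
  IsGeodesicOn g γ S ∧ ∀ s ∈ S, velocity I γ S s ≠ 0 ∧
    g (γ s) (velocity I γ S s) (velocity I γ S s) = 0

/-- Future-pointing curve with respect to the time orientation given by the timelike field `Y`. -/
def IsFuturePointingOn (g : TwoTensor I M) (Y : ∀ p : M, TangentSpace I p) (γ : ℝ → M)
    (S : Set ℝ) : Prop :=
  ∀ s ∈ S, g (γ s) (velocity I γ S s) (Y (γ s)) < 0

end LeviCivita

/-! ## Finsler metrics: fundamental tensor, Cartan tensor, Chern connection, geodesics -/

section Finsler

variable {E : Type*} [NormedAddCommGroup E] [NormedSpace ℝ E]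

/-- Fundamental tensor `g_{ij}(a, y) = ½ ∂²(F²)/∂yⁱ∂yʲ` of `F = F(a, y)` in coordinates. -/
def fundTensor (F : E → E → ℝ) (a y : E) : E →L[ℝ] E →L[ℝ] ℝ :=
  (1 / 2 : ℝ) • fderiv ℝ (fun y' => fderiv ℝ (fun y'' => F a y'' ^ 2) y') y

/-- Cartan tensor `A_{ijk}(a, y) = (F/2) ∂g_{ij}/∂yᵏ`. It is totally symmetric, so the order
of the arguments is irrelevant. -/
def cartanTensor (F : E → E → ℝ) (a y : E) : E →L[ℝ] E →L[ℝ] E →L[ℝ] ℝ :=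
  (F a y / 2) • fderiv ℝ (fun y' => fundTensor F a y') y

/-- Formal Christoffel symbols `γⁱⱼₖ(a, y)` of the fundamental tensor (`y` is kept fixed). -/
def formalChristoffel (F : E → E → ℝ) (a y : E) : E →L[ℝ] E →L[ℝ] E :=
  christoffel (fundTensor F a y) (fderiv ℝ (fun a' => fundTensor F a' y) a)

/-- Nonlinear connection `Nⁱⱼ = γⁱⱼₖ yᵏ - (1/F) Aⁱⱼₖ γᵏᵣₛ yʳ yˢ`. -/
def nonlinearConnection (F : E → E → ℝ) (a y : E) : E →L[ℝ] E :=
  formalChristoffel F a y y - (F a y)⁻¹ •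
    (fundTensor F a y).inverse.comp (cartanTensor F a y (formalChristoffel F a y y y))

/-- Components of the Chern connection, contracted with `uʲ` and `vᵏ`:
`Γⁱⱼₖ = γⁱⱼₖ - (1/F) gⁱˡ (A_{ljs} Nˢₖ - A_{jks} Nˢₗ + A_{kls} Nˢⱼ)`. -/
def chernSymbol (F : E → E → ℝ) (a y u v : E) : E :=
  formalChristoffel F a y u v - (F a y)⁻¹ • (fundTensor F a y).inverse
    (cartanTensor F a y u (nonlinearConnection F a y v)
      - (cartanTensor F a y u v).comp (nonlinearConnection F a y)
      + cartanTensor F a y v (nonlinearConnection F a y u))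

variable {H : Type*} [TopologicalSpace H] {I : ModelWithCorners ℝ E H}
  {M : Type*} [TopologicalSpace M] [ChartedSpace H M]

/-- A function on `TM`, such as a Finsler metric, in the preferred chart at `p`. -/
def finslerInChart (F : ∀ p : M, TangentSpace I p → ℝ) (p : M) (a y : E) : ℝ :=
  F ((extChartAt I p).symm a) (chartFrame I p a y)

/-- The covariant derivative `D_T W` at parameter `s`, with reference vector `T = γ̇`, of a vector
field `W` along `γ`, computed in the preferred chart at `γ s`:
`(D_T W)ⁱ = dWⁱ/ds + Wʲ Tᵏ Γⁱⱼₖ(γ, T)`. -/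
def chernAlong (F : ∀ p : M, TangentSpace I p → ℝ) (γ : ℝ → M) (S : Set ℝ)
    (W : ∀ s, TangentSpace I (γ s)) (s : ℝ) : E :=
  derivWithin (fun r => chartVec I (γ s) (γ r) (W r)) S s +
    chernSymbol (finslerInChart F (γ s)) (extChartAt I (γ s) (γ s))
      (chartVec I (γ s) (γ s) (velocity I γ S s))
      (chartVec I (γ s) (γ s) (W s)) (chartVec I (γ s) (γ s) (velocity I γ S s))

/-- Geodesic of a Finsler metric `F`: a smooth regular curve with `D_T (T / F(γ, T)) = 0`,
with reference vector `T = γ̇`. -/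
def IsFinslerGeodesicOn (F : ∀ p : M, TangentSpace I p → ℝ) (γ : ℝ → M) (S : Set ℝ) : Prop :=
  ContMDiffOn 𝓘(ℝ, ℝ) I ∞ γ S ∧ (∀ s ∈ S, velocity I γ S s ≠ 0) ∧
    ∀ s ∈ S, chernAlong F γ S
      (fun r => (F (γ r) (velocity I γ S r))⁻¹ • velocity I γ S r) s = 0

end Finsler

/-! ## Standard stationary spacetimes and the Fermat metric -/

section Stationary

variable {E : Type*} [NormedAddCommGroup E] [NormedSpace ℝ E]
  (M : Type*) [TopologicalSpace M] [ChartedSpace E M] [IsManifold 𝓘(ℝ, E) ∞ M]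

/-- The data of a standard stationary spacetime `M × ℝ`: a Riemannian metric `g₀`, a vector
field `δ` and a positive function `β` on `M`, all smooth. -/
structure StandardStationary where
  g₀ : ContMDiffRiemannianMetric 𝓘(ℝ, E) ∞ E (fun p : M => TangentSpace 𝓘(ℝ, E) p)
  δ : ∀ p : M, TangentSpace 𝓘(ℝ, E) p
  δ_smooth : ContMDiff 𝓘(ℝ, E) 𝓘(ℝ, E).tangent ∞
    (fun p => (⟨p, δ p⟩ : TangentBundle 𝓘(ℝ, E) M))
  β : M → ℝ
  β_smooth : ContMDiff 𝓘(ℝ, E) 𝓘(ℝ, ℝ) ∞ β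
  β_pos : ∀ p, 0 < β p

variable {M}

namespace StandardStationary

/-- The component `y` of a tangent vector `(y, τ)` of `M × ℝ`. -/
def spacePart (z : M × ℝ) :
    TangentSpace (𝓘(ℝ, E).prod 𝓘(ℝ, ℝ)) z →L[ℝ] TangentSpace 𝓘(ℝ, E) z.1 :=
  ContinuousLinearMap.fst ℝ E ℝ

/-- The component `τ` of a tangent vector `(y, τ)` of `M × ℝ`. -/
def timePart (z : M × ℝ) : TangentSpace (𝓘(ℝ, E).prod 𝓘(ℝ, ℝ)) z →L[ℝ] ℝ :=
  ContinuousLinearMap.snd ℝ E ℝ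

/-- The vector field `∂_t` on `M × ℝ`. -/
def timeField (z : M × ℝ) : TangentSpace (𝓘(ℝ, E).prod 𝓘(ℝ, ℝ)) z :=
  ((0 : E), (1 : ℝ))

variable (D : StandardStationary (E := E) M)

/-- The one-form `g₀[δ, ·]` on `M`. -/
def shiftForm (p : M) : TangentSpace 𝓘(ℝ, E) p →L[ℝ] ℝ := D.g₀.inner p (D.δ p)

/-- The Lorentzian metric `g = g₀ + 2 g₀[δ, ·] dt - β dt²` on `M × ℝ` (in polarized form). -/
def metric : TwoTensor (𝓘(ℝ, E).prod 𝓘(ℝ, ℝ)) (M × ℝ) := fun z =>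
  (ContinuousLinearMap.precomp ℝ (spacePart z)).comp ((D.g₀.inner z.1).comp (spacePart z))
    + ((D.shiftForm z.1).comp (spacePart z)).smulRight (timePart z)
    + (timePart z).smulRight ((D.shiftForm z.1).comp (spacePart z))
    - D.β z.1 • (timePart z).smulRight (timePart z)

theorem metric_apply (z : M × ℝ) (v w : TangentSpace (𝓘(ℝ, E).prod 𝓘(ℝ, ℝ)) z) :
    D.metric z v w = D.g₀.inner z.1 (spacePart z v) (spacePart z w)
      + D.g₀.inner z.1 (D.δ z.1) (spacePart z v) * timePart z w
      + timePart z v * D.g₀.inner z.1 (D.δ z.1) (spacePart z w)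
      - D.β z.1 * (timePart z v * timePart z w) := by
  rfl

/-- The conformally rescaled Lorentzian metric `g / β`. -/
def normalizedMetric : TwoTensor (𝓘(ℝ, E).prod 𝓘(ℝ, ℝ)) (M × ℝ) := fun z =>
  (D.β z.1)⁻¹ • D.metric z

/-- The Riemannian metric `g̃₀ = g₀ / β` on `M`. -/
def gTilde (p : M) (v w : TangentSpace 𝓘(ℝ, E) p) : ℝ := D.g₀.inner p v w / D.β p

/-- The square `h[y, y] = g̃₀[δ, y]² + g̃₀[y, y]` of the Riemannian norm of the Fermat metric. -/
def hSq (p : M) (y : TangentSpace 𝓘(ℝ, E) p) : ℝ :=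
  D.gTilde p (D.δ p) y ^ 2 + D.gTilde p y y

/-- The Fermat metric `F(x, y) = g̃₀[δ, y] + √(g̃₀[δ, y]² + g̃₀[y, y])`. -/
def fermat (p : M) (y : TangentSpace 𝓘(ℝ, E) p) : ℝ :=
  D.gTilde p (D.δ p) y + Real.sqrt (D.hSq p y)

end StandardStationary

end Stationary

end FermatPrinciple

end

/-! Write `θ = g̃₀[δ, ·]`. Completing the square gives `g/β = h - (dt - θ)²` with `h = g̃₀ + θ²`,
while the Fermat metric is the Randers metric `F = θ + √h`. Both geodesic problems reduce to one
Euler–Lagrange system, that of `½ h(ẋ, ẋ) + ℓ θ(ẋ)` (`eulerLagrange`).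

On the Lorentzian side, `ℓ = ṫ - θ(ẋ) = -(g/β)[ż, ∂_t]` is conserved, since nothing depends on `t`,
and the remaining equations are the system above for this `ℓ` (`stationary_geodesic_equation_iff`).
Future-pointing means `ℓ > 0`, and null means `h(ẋ, ẋ) = ℓ²`; together they say `ṫ = θ(ẋ) + √h(ẋ, ẋ)
= F(ẋ)`.

On the Finsler side, the fundamental tensor is homogeneous of degree 0 in `y`, so the Cartan tensor
vanishes on the reference vector and the Chern connection contributes only formal Christoffel
symbols (`chernSymbol_randers`). Lowering the index with the nondegenerate fundamental tensor and
using that `h(ẋ, ẋ) = c` is constant, the equation `D_T(T/F) = 0` becomes `1/√c` times the system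
with `ℓ = √c` (`geodesic_equation_iff`).

The computations are done in a chart with abstract coefficients `h`, `θ`, and transferred to the
manifold by `leviCivitaAlong_eq_zero_iff` and `chernAlong_fermat_eq_zero_iff`. -/

open Filter Topology

noncomputable section

namespace FermatPrinciple

/-! ### Raising indices with a nondegenerate form; equality in Cauchy–Schwarz. -/

section LinearAlgebra

variable {E : Type*} [NormedAddCommGroup E] [NormedSpace ℝ E]

/-- The inverse of a nondegenerate form on a finite-dimensional space is a right inverse. -/
theorem apply_inverse_of_nondegenerate [FiniteDimensional ℝ E] (g : E →L[ℝ] E →L[ℝ] ℝ)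
    (hg : ∀ u, g u = 0 → u = 0) (f : E →L[ℝ] ℝ) : g (g.inverse f) = f := by
  have hinj : Function.Injective g := by
    rw [injective_iff_map_eq_zero]; exact hg
  have hdim : Module.finrank ℝ E = Module.finrank ℝ (E →L[ℝ] ℝ) := by
    have e : (E →ₗ[ℝ] ℝ) ≃ₗ[ℝ] (E →L[ℝ] ℝ) := LinearMap.toContinuousLinearMap
    rw [← e.finrank_eq]
    exact (Subspace.dual_finrank_eq (K := ℝ) (V := E)).symm
  let e := (LinearEquiv.ofInjectiveOfFinrankEq (g : E →ₗ[ℝ] (E →L[ℝ] ℝ)) hinj hdim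
    ).toContinuousLinearEquiv
  have he : (e : E →L[ℝ] (E →L[ℝ] ℝ)) = g := by ext; rfl
  rw [← he, ContinuousLinearMap.inverse_equiv]
  simp

/-- A vector plus a raised covector vanishes iff its lowered version does. -/
theorem add_inverse_eq_zero_iff [FiniteDimensional ℝ E] (g : E →L[ℝ] E →L[ℝ] ℝ)
    (hg : ∀ u, g u = 0 → u = 0) (v : E) (f : E →L[ℝ] ℝ) :
    v + g.inverse f = 0 ↔ ∀ w, g v w + f w = 0 := by
  constructor
  · intro h w
    have := congrArg (fun u => g u w) h
    simpa [apply_inverse_of_nondegenerate g hg] using this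
  · intro h
    refine hg _ (ContinuousLinearMap.ext fun w => ?_)
    simpa [apply_inverse_of_nondegenerate g hg] using h w

/-- Strict Cauchy–Schwarz: equality forces proportionality. -/
theorem eq_smul_of_sq_eq {B : E →L[ℝ] E →L[ℝ] ℝ} (hs : ∀ u v, B u v = B v u)
    (hp : ∀ u, u ≠ 0 → 0 < B u u) {y u : E} (hy : y ≠ 0) (h : B y u ^ 2 = B y y * B u u) :
    u = (B y u / B y y) • y := by
  by_contra hne
  have h1 := hp _ (sub_ne_zero.2 hne)
  have h2 := hp y hy
  have h3 : B (u - (B y u / B y y) • y) (u - (B y u / B y y) • y) = 0 := by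
    simp only [map_sub, map_smul, sub_apply, smul_apply,
      smul_eq_mul, hs u y]
    field_simp
    linear_combination -h
  exact absurd h3 h1.ne'

end LinearAlgebra

/-! ### Randers metrics at a fixed point: fundamental tensor and Chern symbol. -/

section Randers

variable {E : Type*} [NormedAddCommGroup E] [NormedSpace ℝ E]

/-- The Randers function `θ(y) + √h(y, y)`. -/
def randers (h : E → E →L[ℝ] E →L[ℝ] ℝ) (θ : E → E →L[ℝ] ℝ) (a y : E) : ℝ :=
  θ a y + Real.sqrt (h a y y)

/-- The left-hand side of the Euler–Lagrange equations of `½ h(y, y) + ℓ θ(y)` at position `a`,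
velocity `y`, acceleration `y'`, applied to the variation `w`. -/
def eulerLagrange (h : E → E →L[ℝ] E →L[ℝ] ℝ) (θ : E → E →L[ℝ] ℝ) (ℓ : ℝ) (a y y' w : E) : ℝ :=
  h a y' w + fderiv ℝ h a y y w - 1 / 2 * fderiv ℝ h a w y y
    + ℓ * (fderiv ℝ θ a y w - fderiv ℝ θ a w y)

/-- The conditions on the pair `(h, θ)` at a point under which `θ + √h` is a Randers metric. -/
structure IsRandersPair (B : E →L[ℝ] E →L[ℝ] ℝ) (θ : E →L[ℝ] ℝ) : Prop where
  symm : ∀ u v, B u v = B v u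
  pos : ∀ u, u ≠ 0 → 0 < B u u
  sq_lt : ∀ u, u ≠ 0 → θ u ^ 2 < B u u

variable {h : E → E →L[ℝ] E →L[ℝ] ℝ} {θ : E → E →L[ℝ] ℝ} {a y : E}

theorem randers_pos (H : IsRandersPair (h a) (θ a)) (hy : y ≠ 0) : 0 < randers h θ a y := by
  have := Real.lt_sqrt_of_sq_lt ((sq_abs _).trans_lt (H.sq_lt y hy))
  have h2 := neg_abs_le (θ a y)
  unfold randers
  linarith

/-- The differential `∂F/∂y` of the Randers function. -/
def randersMomentum (h : E → E →L[ℝ] E →L[ℝ] ℝ) (θ : E → E →L[ℝ] ℝ) (a y : E) : E →L[ℝ] ℝ :=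
  θ a + (Real.sqrt (h a y y))⁻¹ • h a y

theorem hasFDerivAt_sqrt_quadratic (H : IsRandersPair (h a) (θ a)) (hy : y ≠ 0) :
    HasFDerivAt (fun y => Real.sqrt (h a y y)) ((Real.sqrt (h a y y))⁻¹ • h a y) y := by
  have h1 : HasFDerivAt (fun y => h a y y) ((2 : ℝ) • h a y) y := by
    have := (h a).hasFDerivAt.clm_apply (hasFDerivAt_id (𝕜 := ℝ) y)
    refine this.congr_fderiv ?_
    ext u
    simp [H.symm u y]
    ring
  refine (h1.sqrt (H.pos y hy).ne').congr_fderiv ?_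
  ext u
  simp
  ring

theorem hasFDerivAt_randers (H : IsRandersPair (h a) (θ a)) (hy : y ≠ 0) :
    HasFDerivAt (randers h θ a) (randersMomentum h θ a y) y :=
  (θ a).hasFDerivAt.add (hasFDerivAt_sqrt_quadratic H hy)

/-- This is `½ D²(F²) = DF ⊗ DF + F · D²F`; as `θ` is linear, `D²F` is the Hessian of `√h` alone. -/
theorem fundTensor_randers_apply (H : IsRandersPair (h a) (θ a)) (hy : y ≠ 0) (u v : E) :
    fundTensor (randers h θ) a y u v
      = randersMomentum h θ a y u * randersMomentum h θ a y v
        + randers h θ a y * ((Real.sqrt (h a y y))⁻¹ * h a u v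
          - (Real.sqrt (h a y y))⁻¹ ^ 3 * (h a y u * h a y v)) := by
  have hR : 0 < Real.sqrt (h a y y) := Real.sqrt_pos.2 (H.pos y hy)
  have e1 : (fun y' => fderiv ℝ (fun y'' => randers h θ a y'' ^ 2) y')
      =ᶠ[𝓝 y] fun y' => (2 * randers h θ a y') • randersMomentum h θ a y' := by
    filter_upwards [isOpen_ne.mem_nhds hy] with y' hy'
    rw [((hasFDerivAt_randers H hy').pow 2).fderiv]
    ext w
    simp
  have e2 : HasFDerivAt (randersMomentum h θ a)
      ((Real.sqrt (h a y y))⁻¹ • h a +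
        (-(Real.sqrt (h a y y) ^ 2)⁻¹ • (Real.sqrt (h a y y))⁻¹ • h a y).smulRight (h a y)) y := by
    have := ((hasDerivAt_inv hR.ne').comp_hasFDerivAt y (hasFDerivAt_sqrt_quadratic H hy)).smul (h a).hasFDerivAt
    exact this.const_add _
  have e3 := ((hasFDerivAt_randers H hy).const_mul 2).smul e2
  unfold fundTensor
  rw [e1.fderiv_eq, HasFDerivAt.fderiv (f := fun y => (2 * randers h θ a y) • randersMomentum h θ a y) e3]
  simp
  field_simp
  ring

theorem randersMomentum_self (H : IsRandersPair (h a) (θ a)) (hy : y ≠ 0) :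
    randersMomentum h θ a y y = randers h θ a y := by
  have hR : 0 < Real.sqrt (h a y y) := Real.sqrt_pos.2 (H.pos y hy)
  have h2 : h a y y = Real.sqrt (h a y y) ^ 2 := (Real.sq_sqrt (H.pos y hy).le).symm
  simp only [randersMomentum, randers, add_apply, smul_apply, smul_eq_mul]
  nth_rewrite 2 [h2]
  field_simp

/-- The Hessian of the 1-homogeneous function `√h` annihilates `y`, and `DF(y) = F` by Euler's
identity. -/
theorem fundTensor_randers_self (H : IsRandersPair (h a) (θ a)) (hy : y ≠ 0) (w : E) :
    fundTensor (randers h θ) a y y w = randers h θ a y * randersMomentum h θ a y w := by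
  have hR : 0 < Real.sqrt (h a y y) := Real.sqrt_pos.2 (H.pos y hy)
  have h2 : h a y y = Real.sqrt (h a y y) ^ 2 := (Real.sq_sqrt (H.pos y hy).le).symm
  rw [fundTensor_randers_apply H hy]
  have h4 : (Real.sqrt (h a y y))⁻¹ * h a y w
      - (Real.sqrt (h a y y))⁻¹ ^ 3 * (h a y y * h a y w) = 0 := by
    set R := Real.sqrt (h a y y)
    rw [h2]; field_simp; ring
  rw [randersMomentum_self H hy, h4]; ring

/-- Pairing a kernel vector `u` with `y` gives `DF(u) = 0`; pairing it with itself then gives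
equality in Cauchy–Schwarz for `h`, so `u` is a multiple of `y`. Since `DF(y) = F > 0`, the multiple
is zero. -/
theorem fundTensor_randers_nondegenerate (H : IsRandersPair (h a) (θ a)) (hy : y ≠ 0) (u : E)
    (hu : fundTensor (randers h θ) a y u = 0) : u = 0 := by
  have hR : 0 < Real.sqrt (h a y y) := Real.sqrt_pos.2 (H.pos y hy)
  have h2 : h a y y = Real.sqrt (h a y y) ^ 2 := (Real.sq_sqrt (H.pos y hy).le).symm
  have hF := randers_pos H hy
  have h1 : fundTensor (randers h θ) a y u u = 0 := by simp [hu]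
  have h0 : fundTensor (randers h θ) a y u y = 0 := by simp [hu]
  have hsym : fundTensor (randers h θ) a y u y = fundTensor (randers h θ) a y y u := by
    rw [fundTensor_randers_apply H hy, fundTensor_randers_apply H hy, H.symm u y]; ring
  rw [hsym, fundTensor_randers_self H hy] at h0
  have hp : randersMomentum h θ a y u = 0 := (mul_eq_zero.1 h0).resolve_left hF.ne'
  rw [fundTensor_randers_apply H hy, hp] at h1
  have h4 : (Real.sqrt (h a y y))⁻¹ * h a u u
      - (Real.sqrt (h a y y))⁻¹ ^ 3 * (h a y u * h a y u) = 0 := by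
    have : randers h θ a y * ((Real.sqrt (h a y y))⁻¹ * h a u u
      - (Real.sqrt (h a y y))⁻¹ ^ 3 * (h a y u * h a y u)) = 0 := by linarith
    exact (mul_eq_zero.1 this).resolve_left hF.ne'
  have h5 : h a y u ^ 2 = h a y y * h a u u := by
    rw [h2]
    field_simp at h4
    linarith
  have h6 := eq_smul_of_sq_eq H.symm H.pos hy h5
  rw [h6, map_smul, randersMomentum_self H hy, smul_eq_mul] at hp
  rw [h6, (mul_eq_zero.1 hp).resolve_right hF.ne', zero_smul]

theorem randers_smul (t : ℝ) (ht : 0 < t) : randers h θ a (t • y) = t * randers h θ a y := by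
  have : h a (t • y) (t • y) = t ^ 2 * h a y y := by simp; ring
  rw [randers, randers, this, Real.sqrt_mul (sq_nonneg t), Real.sqrt_sq ht.le]
  simp; ring

/-- Homogeneity of degree 0 is what makes the Cartan tensor vanish in the direction `y`. -/
theorem fundTensor_randers_smul (H : IsRandersPair (h a) (θ a)) (hy : y ≠ 0) (t : ℝ)
    (ht : 0 < t) : fundTensor (randers h θ) a (t • y) = fundTensor (randers h θ) a y := by
  have hR : 0 < Real.sqrt (h a y y) := Real.sqrt_pos.2 (H.pos y hy)
  have e : Real.sqrt (h a (t • y) (t • y)) = t * Real.sqrt (h a y y) := by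
    have : h a (t • y) (t • y) = t ^ 2 * h a y y := by simp; ring
    rw [this, Real.sqrt_mul (sq_nonneg t), Real.sqrt_sq ht.le]
  ext u v
  rw [fundTensor_randers_apply H (smul_ne_zero ht.ne' hy), fundTensor_randers_apply H hy,
    randers_smul t ht]
  simp only [randersMomentum, e]
  simp only [map_smul, add_apply,
      smul_apply, smul_eq_mul]
  field_simp

/-- The radial derivative of a function that is constant on the open ray through `y` vanishes. -/
theorem fderiv_radial_eq_zero {V : Type*} [NormedAddCommGroup V] [NormedSpace ℝ V] {f : E → V}
    (hf : ∀ t : ℝ, 0 < t → f (t • y) = f y) : fderiv ℝ f y y = 0 := by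
  by_cases hd : DifferentiableAt ℝ f y
  · have h1 : HasDerivAt (fun t : ℝ => t • y) y 1 := by
      simpa using (hasDerivAt_id (1 : ℝ)).smul_const y
    have h2 : HasDerivAt (fun t : ℝ => f (t • y)) (fderiv ℝ f y y) 1 := by
      have h3 : HasFDerivAt f (fderiv ℝ f y) ((1 : ℝ) • y) := by simpa using hd.hasFDerivAt
      exact h3.comp_hasDerivAt (1 : ℝ) h1
    have h4 : HasDerivAt (fun t : ℝ => f (t • y)) 0 1 := by
      refine (hasDerivAt_const (1 : ℝ) (f y)).congr_of_eventuallyEq ?_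
      filter_upwards [isOpen_Ioi.mem_nhds (show (1 : ℝ) ∈ Ioi (0 : ℝ) by simp)] with t ht
      exact hf t ht
    exact h2.unique h4
  -- Without differentiability `fderiv` takes the default value 0, so the claim still holds.
  · simp [fderiv_zero_of_not_differentiableAt hd]

/-- With both lower slots filled by multiples of `y`, every Cartan term has such a multiple as its
first argument, so the nonlinear connection drops out. -/
theorem chernSymbol_eq_of_cartan_self {F : E → E → ℝ} (hA : cartanTensor F a y y = 0) (c : ℝ) :
    chernSymbol F a y (c • y) y = c • formalChristoffel F a y y y := by
  simp [chernSymbol, hA, ContinuousLinearMap.inverse]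

theorem chernSymbol_randers (H : IsRandersPair (h a) (θ a)) (hy : y ≠ 0) (c : ℝ) :
    chernSymbol (randers h θ) a y (c • y) y
      = c • formalChristoffel (randers h θ) a y y y := by
  refine chernSymbol_eq_of_cartan_self ?_ c
  simp only [cartanTensor, smul_apply]
  rw [fderiv_radial_eq_zero (fun t ht => fundTensor_randers_smul H hy t ht), smul_zero]

end Randers

/-! ### Position dependence of a Randers metric and its geodesic equation. -/

section RandersSpray

variable {E : Type*} [NormedAddCommGroup E] [NormedSpace ℝ E]

variable {h : E → E →L[ℝ] E →L[ℝ] ℝ} {θ : E → E →L[ℝ] ℝ} {U : Set E} {a y : E}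

/-- A field of Randers pairs, continuously differentiable on the open set `U`. -/
structure IsRandersField (h : E → E →L[ℝ] E →L[ℝ] ℝ) (θ : E → E →L[ℝ] ℝ) (U : Set E) : Prop where
  isOpen : IsOpen U
  contDiffOn_form : ContDiffOn ℝ 1 h U
  contDiffOn_shift : ContDiffOn ℝ 1 θ U
  isRandersPair : ∀ a ∈ U, IsRandersPair (h a) (θ a)

namespace IsRandersField

variable (H : IsRandersField h θ U)

include H

theorem hasFDerivAt_form (ha : a ∈ U) : HasFDerivAt h (fderiv ℝ h a) a :=
  ((H.contDiffOn_form.contDiffAt (H.isOpen.mem_nhds ha)).differentiableAt (by simp)).hasFDerivAt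

theorem hasFDerivAt_shift (ha : a ∈ U) : HasFDerivAt θ (fderiv ℝ θ a) a :=
  ((H.contDiffOn_shift.contDiffAt (H.isOpen.mem_nhds ha)).differentiableAt (by simp)).hasFDerivAt

theorem hasFDerivAt_form_apply (ha : a ∈ U) (v w : E) :
    HasFDerivAt (fun a' => h a' v w) (((fderiv ℝ h a).flip v).flip w) a := by
  have h1 := ((H.hasFDerivAt_form ha).clm_apply (hasFDerivAt_const v a)).clm_apply
    (hasFDerivAt_const w a)
  refine h1.congr_fderiv ?_
  ext u
  simp

theorem hasFDerivAt_shift_apply (ha : a ∈ U) (v : E) :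
    HasFDerivAt (fun a' => θ a' v) ((fderiv ℝ θ a).flip v) a := by
  have h1 := (H.hasFDerivAt_shift ha).clm_apply (hasFDerivAt_const v a)
  refine h1.congr_fderiv ?_
  ext u
  simp

theorem sqrt_pos (ha : a ∈ U) (hy : y ≠ 0) : 0 < Real.sqrt (h a y y) :=
  Real.sqrt_pos.2 ((H.isRandersPair a ha).pos y hy)

theorem differentiableAt_fundTensor [FiniteDimensional ℝ E] (ha : a ∈ U) (hy : y ≠ 0) :
    DifferentiableAt ℝ (fun a' => fundTensor (randers h θ) a' y) a := by
  have key : ContDiffOn ℝ 1 (fun a' => fundTensor (randers h θ) a' y) U := by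
    rw [contDiffOn_clm_apply]
    intro u
    rw [contDiffOn_clm_apply]
    intro v
    have cθ : ∀ v, ContDiffOn ℝ 1 (fun a' => θ a' v) U := fun v =>
      H.contDiffOn_shift.clm_apply contDiffOn_const
    have ch : ∀ v w, ContDiffOn ℝ 1 (fun a' => h a' v w) U := fun v w =>
      (H.contDiffOn_form.clm_apply contDiffOn_const).clm_apply contDiffOn_const
    have cR : ContDiffOn ℝ 1 (fun a' => Real.sqrt (h a' y y)) U :=
      (ch y y).sqrt fun b hb => ((H.isRandersPair b hb).pos y hy).ne'
    have cR' : ContDiffOn ℝ 1 (fun a' => (Real.sqrt (h a' y y))⁻¹) U :=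
      cR.inv fun b hb => (H.sqrt_pos hb hy).ne'
    have cp : ∀ v, ContDiffOn ℝ 1 (fun a' => randersMomentum h θ a' y v) U := fun v =>
      (cθ v).add (cR'.mul (ch y v))
    have cF : ContDiffOn ℝ 1 (fun a' => randers h θ a' y) U := (cθ y).add cR
    refine (((cp u).mul (cp v)).add (cF.mul ((cR'.mul (ch u v)).sub
      ((cR'.pow 3).mul ((ch y u).mul (ch y v)))))).congr fun b hb => ?_
    exact fundTensor_randers_apply (H.isRandersPair b hb) hy u v
  exact (key.contDiffAt (H.isOpen.mem_nhds ha)).differentiableAt (by simp)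

theorem hasFDerivAt_sqrt (ha : a ∈ U) (hy : y ≠ 0) :
    HasFDerivAt (fun a' => Real.sqrt (h a' y y))
      ((1 / (2 * Real.sqrt (h a y y))) • ((fderiv ℝ h a).flip y).flip y) a :=
  (H.hasFDerivAt_form_apply ha y y).sqrt ((H.isRandersPair a ha).pos y hy).ne'

/-- The Christoffel terms of the geodesic equation only involve entries with `y` in one slot, so it
suffices to differentiate the short expression `F · DF(w)` in the position. -/
theorem fderiv_fundTensor_self_apply [FiniteDimensional ℝ E] (ha : a ∈ U) (hy : y ≠ 0) (u w : E) :
    fderiv ℝ (fun a' => fundTensor (randers h θ) a' y) a u y w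
      = (fderiv ℝ θ a u y + 1 / (2 * Real.sqrt (h a y y)) * fderiv ℝ h a u y y)
          * randersMomentum h θ a y w
        + randers h θ a y * (fderiv ℝ θ a u w + (Real.sqrt (h a y y))⁻¹ * fderiv ℝ h a u y w
          - (Real.sqrt (h a y y) ^ 2)⁻¹ *
            (1 / (2 * Real.sqrt (h a y y)) * fderiv ℝ h a u y y) * h a y w) := by
  have h1 := (((H.differentiableAt_fundTensor ha hy).hasFDerivAt.clm_apply
    (hasFDerivAt_const y a)).clm_apply (hasFDerivAt_const w a))
  have hR := H.hasFDerivAt_sqrt ha hy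
  have hR' := (hasDerivAt_inv (H.sqrt_pos ha hy).ne').comp_hasFDerivAt a hR
  have h2 : HasFDerivAt (fun a' => fundTensor (randers h θ) a' y y w) _ a :=
    (((H.hasFDerivAt_shift_apply ha y).add hR).mul
      ((H.hasFDerivAt_shift_apply ha w).add (hR'.mul (H.hasFDerivAt_form_apply ha y w)))
      ).congr_of_eventuallyEq (by
        filter_upwards [H.isOpen.mem_nhds ha] with b hb
        rw [fundTensor_randers_self (H.isRandersPair b hb) hy]
        rfl)
  have h3 := congrArg (fun f : E →L[ℝ] ℝ => f u) (h1.unique h2)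
  have hpos := H.sqrt_pos ha hy
  simp at h3
  rw [h3]
  simp only [randersMomentum, randers, add_apply, smul_apply, smul_eq_mul]
  field_simp
  ring

theorem hasDerivWithinAt_shift {c v : ℝ → E} {c' v' : E} {S : Set ℝ} {s : ℝ} (hs : c s ∈ U)
    (hc : HasDerivWithinAt c c' S s) (hv : HasDerivWithinAt v v' S s) :
    HasDerivWithinAt (fun r => θ (c r) (v r)) (fderiv ℝ θ (c s) c' (v s) + θ (c s) v') S s :=
  ((H.hasFDerivAt_shift hs).comp_hasDerivWithinAt s hc).clm_apply hv

theorem hasDerivWithinAt_form {c v : ℝ → E} {c' v' : E} {S : Set ℝ} {s : ℝ} (hs : c s ∈ U)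
    (hc : HasDerivWithinAt c c' S s) (hv : HasDerivWithinAt v v' S s) :
    HasDerivWithinAt (fun r => h (c r) (v r) (v r))
      (fderiv ℝ h (c s) c' (v s) (v s) + 2 * h (c s) (v s) v') S s := by
  refine ((((H.hasFDerivAt_form hs).comp_hasDerivWithinAt s hc).clm_apply hv).clm_apply
    hv).congr_deriv ?_
  simp only [add_apply, Function.comp]
  rw [(H.isRandersPair _ hs).symm v']
  ring

/-- Geodesic equation of a Randers metric along a curve on which `h(ẋ, ẋ)` is constant. -/
theorem geodesic_equation_iff [FiniteDimensional ℝ E] (ha : a ∈ U) (hy : y ≠ 0) (y' : E)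
    (hconst : fderiv ℝ h a y y y + 2 * h a y y' = 0) :
    ((randers h θ a y)⁻¹ • y'
        + (-(fderiv ℝ θ a y y + θ a y') / randers h θ a y ^ 2) • y
        + chernSymbol (randers h θ) a y ((randers h θ a y)⁻¹ • y) y = 0) ↔
      ∀ w, eulerLagrange h θ (Real.sqrt (h a y y)) a y y' w = 0 := by
  have HP := H.isRandersPair a ha
  have hF := randers_pos HP hy
  have hR := H.sqrt_pos ha hy
  rw [chernSymbol_randers HP hy, formalChristoffel, christoffel_apply,
    ← map_smul (fundTensor (randers h θ) a y).inverse, add_inverse_eq_zero_iff _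
      (fun u hu => fundTensor_randers_nondegenerate HP hy u hu)]
  refine forall_congr' fun w => ?_
  simp only [map_add, map_smul, add_apply, smul_apply, smul_eq_mul, christoffelFirst_apply]
  have hyy : h a y y = Real.sqrt (h a y y) ^ 2 := (Real.sq_sqrt (HP.pos y hy).le).symm
  have hDh : fderiv ℝ h a y y y = -(2 * h a y y') := by linarith
  -- The derivative of `g(y, y) = F²` in the position, that is `2 F ∂F`.
  have e : ∀ w, fderiv ℝ (fun a' => fundTensor (randers h θ) a' y) a w y y =
      2 * (randers h θ a y * (fderiv ℝ θ a w y
        + 1 / (2 * Real.sqrt (h a y y)) * fderiv ℝ h a w y y)) := by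
    intro w
    rw [H.fderiv_fundTensor_self_apply ha hy, randersMomentum_self HP hy]
    simp only [randers]
    set R := Real.sqrt (h a y y)
    rw [hyy]
    field_simp
    ring
  rw [H.fderiv_fundTensor_self_apply ha hy y w, e w, fundTensor_randers_apply HP hy,
    fundTensor_randers_self HP hy, hDh]
  -- The lowered equation tested on `w` equals the Euler–Lagrange expression divided by `√h(y, y)`:
  -- by constancy of `h(ẋ, ẋ)` the terms along `DF(w)` cancel.
  have key : ∀ L : ℝ, L = (Real.sqrt (h a y y))⁻¹ *
      eulerLagrange h θ (Real.sqrt (h a y y)) a y y' w →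
      (L = 0 ↔ eulerLagrange h θ (Real.sqrt (h a y y)) a y y' w = 0) := by
    rintro L rfl
    simp [hR.ne']
  refine key _ ?_
  simp only [eulerLagrange, randersMomentum, add_apply, smul_apply, smul_eq_mul]
  generalize randers h θ a y = F at *
  generalize Real.sqrt (h a y y) = R at *
  field_simp
  ring

end IsRandersField

end RandersSpray

/-! ### The metric `h - (dt - θ)²` in coordinates and its geodesic equation. -/

section StationaryForm

variable {E : Type*} [NormedAddCommGroup E] [NormedSpace ℝ E]

variable {h : E → E →L[ℝ] E →L[ℝ] ℝ} {θ : E → E →L[ℝ] ℝ} {U : Set E} {a : E}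

/-- The one-form `dt - θ` on `E × ℝ`. -/
def timeForm (θ : E →L[ℝ] ℝ) : E × ℝ →L[ℝ] ℝ :=
  ContinuousLinearMap.snd ℝ E ℝ - θ.comp (ContinuousLinearMap.fst ℝ E ℝ)

@[simp] theorem timeForm_apply (θ : E →L[ℝ] ℝ) (v : E × ℝ) : timeForm θ v = v.2 - θ v.1 := rfl

/-- The Lorentzian metric `h - (dt - θ)²` on `E × ℝ`. -/
def stationaryForm (h : E → E →L[ℝ] E →L[ℝ] ℝ) (θ : E → E →L[ℝ] ℝ) (q : E × ℝ) :
    E × ℝ →L[ℝ] E × ℝ →L[ℝ] ℝ :=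
  (ContinuousLinearMap.precomp ℝ (ContinuousLinearMap.fst ℝ E ℝ)).comp
      ((h q.1).comp (ContinuousLinearMap.fst ℝ E ℝ))
    - (timeForm (θ q.1)).smulRight (timeForm (θ q.1))

@[simp] theorem stationaryForm_apply (q v w : E × ℝ) :
    stationaryForm h θ q v w = h q.1 v.1 w.1 - (v.2 - θ q.1 v.1) * (w.2 - θ q.1 w.1) := by
  rfl

/-- Pairing with `∂_t` kills `(dt - θ)(u)`; pairing `u` with itself then leaves the positive
definite part `h`. -/
theorem stationaryForm_nondegenerate {q : E × ℝ} (H : IsRandersPair (h q.1) (θ q.1)) (u : E × ℝ)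
    (hu : stationaryForm h θ q u = 0) : u = 0 := by
  have h1 : stationaryForm h θ q u (0, 1) = 0 := by simp [hu]
  replace h1 : u.2 - θ q.1 u.1 = 0 := by
    rw [← neg_eq_zero]
    simpa using h1
  have h2 : stationaryForm h θ q u u = 0 := by simp [hu]
  rw [stationaryForm_apply, h1, mul_zero, sub_zero] at h2
  have h3 : u.1 = 0 := by
    by_contra hne
    exact (H.pos _ hne).ne' h2
  rw [h3] at h1
  ext
  · exact h3
  · simpa using h1

namespace IsRandersField

variable (H : IsRandersField h θ U)

include H

theorem differentiableAt_stationaryForm [FiniteDimensional ℝ E] {q : E × ℝ} (hq : q.1 ∈ U) :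
    DifferentiableAt ℝ (stationaryForm h θ) q := by
  have hopen : IsOpen (Prod.fst ⁻¹' U : Set (E × ℝ)) := H.isOpen.preimage continuous_fst
  have key : ContDiffOn ℝ 1 (stationaryForm h θ) (Prod.fst ⁻¹' U : Set (E × ℝ)) := by
    rw [contDiffOn_clm_apply]
    intro v
    rw [contDiffOn_clm_apply]
    intro w
    have cθ : ∀ v, ContDiffOn ℝ 1 (fun q : E × ℝ => θ q.1 v) (Prod.fst ⁻¹' U) := fun v =>
      (H.contDiffOn_shift.comp contDiffOn_fst (mapsTo_preimage _ _)).clm_apply contDiffOn_const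
    have ch : ContDiffOn ℝ 1 (fun q : E × ℝ => h q.1 v.1 w.1) (Prod.fst ⁻¹' U) :=
      ((H.contDiffOn_form.comp contDiffOn_fst (mapsTo_preimage _ _)).clm_apply
        contDiffOn_const).clm_apply contDiffOn_const
    exact ch.sub ((contDiffOn_const.sub (cθ v.1)).mul (contDiffOn_const.sub (cθ w.1)))
  exact (key.contDiffAt (hopen.mem_nhds hq)).differentiableAt (by simp)

theorem fderiv_stationaryForm_apply [FiniteDimensional ℝ E] {q : E × ℝ} (hq : q.1 ∈ U)
    (u v w : E × ℝ) :
    fderiv ℝ (stationaryForm h θ) q u v w = fderiv ℝ h q.1 u.1 v.1 w.1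
      + fderiv ℝ θ q.1 u.1 v.1 * (w.2 - θ q.1 w.1)
      + (v.2 - θ q.1 v.1) * fderiv ℝ θ q.1 u.1 w.1 := by
  have h1 := (((H.differentiableAt_stationaryForm hq).hasFDerivAt.clm_apply
    (hasFDerivAt_const v q)).clm_apply (hasFDerivAt_const w q))
  have hfst : HasFDerivAt Prod.fst (ContinuousLinearMap.fst ℝ E ℝ) q := hasFDerivAt_fst
  have ct : ∀ v : E × ℝ, HasFDerivAt (fun q : E × ℝ => v.2 - θ q.1 v.1) _ q := fun v =>
    ((H.hasFDerivAt_shift_apply hq v.1).comp q hfst).const_sub v.2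
  have h2 : HasFDerivAt (fun q => stationaryForm h θ q v w) _ q :=
    ((H.hasFDerivAt_form_apply hq v.1 w.1).comp q hfst).sub ((ct v).mul (ct w))
  have h3 := congrArg (fun f : E × ℝ →L[ℝ] ℝ => f u) (h1.unique h2)
  simp at h3
  rw [h3]
  ring

/-- The geodesic equation of `h - (dt - θ)²`. -/
theorem stationary_geodesic_equation_iff [FiniteDimensional ℝ E] {q : E × ℝ} (hq : q.1 ∈ U)
    (v v' : E × ℝ) :
    v' + christoffel (stationaryForm h θ q) (fderiv ℝ (stationaryForm h θ) q) v v = 0 ↔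
      v'.2 - θ q.1 v'.1 - fderiv ℝ θ q.1 v.1 v.1 = 0 ∧
        ∀ w, eulerLagrange h θ (v.2 - θ q.1 v.1) q.1 v.1 v'.1 w = 0 := by
  rw [christoffel_apply, add_inverse_eq_zero_iff _
    (stationaryForm_nondegenerate (H.isRandersPair _ hq))]
  -- The lowered equation splits along `w.1` and `(dt - θ)(w)`; the coefficient of the latter is
  -- minus the derivative of `ṫ - θ(ẋ)`.
  have key : ∀ w : E × ℝ, stationaryForm h θ q v' w
      + christoffelFirst (fderiv ℝ (stationaryForm h θ) q) v v w
      = eulerLagrange h θ (v.2 - θ q.1 v.1) q.1 v.1 v'.1 w.1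
        - (v'.2 - θ q.1 v'.1 - fderiv ℝ θ q.1 v.1 v.1) * (w.2 - θ q.1 w.1) := by
    intro w
    simp only [christoffelFirst_apply, H.fderiv_stationaryForm_apply hq, stationaryForm_apply,
      eulerLagrange]
    ring
  simp only [key]
  constructor
  · intro hw
    have h1 : v'.2 - θ q.1 v'.1 - fderiv ℝ θ q.1 v.1 v.1 = 0 := by
      -- Testing with `∂_t` isolates the conservation law; purely spatial `w` then give the rest.
      have := hw (0, 1)
      simp [eulerLagrange] at this
      linarith
    refine ⟨h1, fun w => ?_⟩
    simpa [h1] using hw (w, 0)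
  · rintro ⟨h1, h2⟩ w
    simp [h1, h2]

end IsRandersField

end StationaryForm

/-! ### Curves, frames and covariant derivatives in a chart. -/

section Charts

variable {E : Type*} [NormedAddCommGroup E] [NormedSpace ℝ E]
  {H : Type*} [TopologicalSpace H] {I : ModelWithCorners ℝ E H}
  {M : Type*} [TopologicalSpace M] [ChartedSpace H M]

/-- The coordinate expression of a curve in the preferred chart at `p`. -/
def chartCurve (I : ModelWithCorners ℝ E H) (p : M) (γ : ℝ → M) (r : ℝ) : E :=
  extChartAt I p (γ r)

theorem eventually_mem_source {γ : ℝ → M} {S : Set ℝ} {s : ℝ} {p : M}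
    (hγ : ContinuousWithinAt γ S s) (hp : γ s ∈ (extChartAt I p).source) :
    ∀ᶠ r in 𝓝[S] s, γ r ∈ (extChartAt I p).source :=
  hγ ((isOpen_extChartAt_source p).mem_nhds hp)

variable [IsManifold I ∞ M]

theorem contDiffWithinAt_chartCurve {γ : ℝ → M} {S : Set ℝ} {s : ℝ} {p : M}
    (hγ : ContMDiffWithinAt 𝓘(ℝ, ℝ) I ∞ γ S s) (hp : γ s ∈ (extChartAt I p).source) :
    ContDiffWithinAt ℝ ∞ (chartCurve I p γ) S s := by
  rw [← contMDiffWithinAt_iff_contDiffWithinAt]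
  have := contMDiffAt_extChartAt' (I := I) (n := ∞) (x := p) (by simpa using hp)
  exact this.comp_contMDiffWithinAt s hγ

theorem chartVec_velocity {γ : ℝ → M} {S : Set ℝ} {s : ℝ} {p : M}
    (hγ : ContMDiffWithinAt 𝓘(ℝ, ℝ) I ∞ γ S s) (hS : UniqueDiffWithinAt ℝ S s)
    (hp : γ s ∈ (extChartAt I p).source) :
    chartVec I p (γ s) (velocity I γ S s) = derivWithin (chartCurve I p γ) S s := by
  have h1 := mfderiv_comp_mfderivWithin (I := 𝓘(ℝ, ℝ)) (I' := I) (I'' := 𝓘(ℝ, E)) (s := S) s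
    (mdifferentiableAt_extChartAt (I := I) (x := p) (by simpa using hp))
    (hγ.mdifferentiableWithinAt (by simp)) hS.uniqueMDiffWithinAt
  rw [mfderivWithin_eq_fderivWithin] at h1
  rw [← fderivWithin_derivWithin]
  exact (congrArg (fun f : ℝ →L[ℝ] E => f 1) h1).symm

/-- Going to coordinates and back returns to `q` only up to a propositional equality, so vectors in
the two tangent spaces are compared through a function on all of `TM`. The free target `α` covers
both real values and the predicate `v = 0`. -/
theorem frame_chartVec {α : Type*} (f : ∀ p : M, TangentSpace I p → α) {p q : M}
    (hq : q ∈ (extChartAt I p).source) (v : TangentSpace I q) :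
    f ((extChartAt I p).symm (extChartAt I p q)) (chartFrame I p (extChartAt I p q)
      (chartVec I p q v)) = f q v := by
  have h1 : (chartFrame I p (extChartAt I p q) (chartVec I p q v) : E) = v :=
    congrArg (fun f : E →L[ℝ] E => f v)
      (mfderivWithin_extChartAt_symm_comp_mfderiv_extChartAt' (I := I) hq)
  have h2 : ∀ q' : M, q' = q → ∀ w : E, w = v → f q' w = f q v := by
    rintro q' rfl w rfl; rfl
  exact h2 _ ((extChartAt I p).left_inv hq) _ h1

theorem chartFrame_injective {p : M} {a : E} (ha : a ∈ (extChartAt I p).target)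
    {u : E} (hu : chartFrame I p a u = 0) : u = 0 := by
  have h1 := congrArg (fun f : E →L[ℝ] E => f u)
      (mfderiv_extChartAt_comp_mfderivWithin_extChartAt_symm (I := I) ha)
  have h2 : mfderiv I 𝓘(ℝ, E) (extChartAt I p) ((extChartAt I p).symm a)
      (chartFrame I p a u) = u := h1
  rw [hu] at h2
  rw [← h2]
  exact (map_zero _)

theorem leviCivitaAlong_velocity (g : TwoTensor I M) {γ : ℝ → M} {S : Set ℝ}
    {s : ℝ} (hS : UniqueDiffOn ℝ S) (hγ : ContMDiffOn 𝓘(ℝ, ℝ) I ∞ γ S) (hs : s ∈ S) :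
    leviCivitaAlong g γ S (velocity I γ S) s
      = derivWithin (derivWithin (chartCurve I (γ s) γ) S) S s
        + leviCivitaSymbol g (γ s) (extChartAt I (γ s) (γ s))
          (derivWithin (chartCurve I (γ s) γ) S s) (derivWithin (chartCurve I (γ s) γ) S s) := by
  have hp := mem_extChartAt_source (I := I) (γ s)
  have e : (fun r => chartVec I (γ s) (γ r) (velocity I γ S r))
      =ᶠ[𝓝[S] s] derivWithin (chartCurve I (γ s) γ) S := by
    filter_upwards [eventually_mem_source (hγ s hs).continuousWithinAt hp,
      self_mem_nhdsWithin] with r hr hrS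
    exact chartVec_velocity (hγ r hrS) (hS r hrS) hr
  unfold leviCivitaAlong
  rw [chartVec_velocity (hγ s hs) (hS s hs) hp, e.derivWithin_eq_of_mem hs]

/-- The frame field is the image of the constant section `u` under the tangent map of the inverse
chart. -/
theorem contMDiffOn_chartFrame [I.Boundaryless] (p : M) (u : E) :
    ContMDiffOn 𝓘(ℝ, E) I.tangent ∞
      (fun a => (⟨(extChartAt I p).symm a, chartFrame I p a u⟩ : TangentBundle I M))
      (extChartAt I p).target := by
  have hU := isOpen_extChartAt_target (I := I) p
  have h1 := (contMDiffOn_extChartAt_symm (I := I) (n := ∞) p).contMDiffOn_tangentMapWithin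
    (m := ∞) (by simp) hU.uniqueMDiffOn
  have h2 : ContMDiff 𝓘(ℝ, E) 𝓘(ℝ, E).tangent ∞ (fun a : E => (⟨a, u⟩ : TangentBundle 𝓘(ℝ, E) E)) :=
    contMDiff_vectorSpace_iff_contDiff.2 contDiff_const
  refine (h1.comp h2.contMDiffOn (fun a ha => ha)).congr fun a ha => ?_
  simp only [Function.comp, tangentMapWithin, chartFrame]
  rw [mfderivWithin_of_isOpen hU ha, I.range_eq_univ, mfderivWithin_univ]
  rfl

end Charts

/-! ### The Fermat data `h`, `θ` of a stationary spacetime and their chart components. -/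

namespace StandardStationary

variable {E : Type*} [NormedAddCommGroup E] [NormedSpace ℝ E]
  {M : Type*} [TopologicalSpace M] [ChartedSpace E M] [IsManifold 𝓘(ℝ, E) ∞ M]
  (D : StandardStationary (E := E) M)

/-- The one-form `g̃₀[δ, ·]`. -/
def fermatShift (p : M) : TangentSpace 𝓘(ℝ, E) p →L[ℝ] ℝ := (D.β p)⁻¹ • D.shiftForm p

/-- The Riemannian metric `h = g̃₀ + g̃₀[δ, ·]²`. -/
def fermatForm : TwoTensor 𝓘(ℝ, E) M := fun p =>
  (D.β p)⁻¹ • D.g₀.inner p + (D.fermatShift p).smulRight (D.fermatShift p)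

theorem fermatShift_apply (p : M) (v : TangentSpace 𝓘(ℝ, E) p) :
    D.fermatShift p v = D.gTilde p (D.δ p) v := by
  simp [fermatShift, gTilde, shiftForm, div_eq_inv_mul]

theorem fermatForm_apply (p : M) (v w : TangentSpace 𝓘(ℝ, E) p) :
    D.fermatForm p v w = D.gTilde p v w + D.fermatShift p v * D.fermatShift p w := by
  simp [fermatForm, gTilde, div_eq_inv_mul]

theorem fermatForm_self (p : M) (v : TangentSpace 𝓘(ℝ, E) p) :
    D.fermatForm p v v = D.hSq p v := by
  rw [fermatForm_apply, hSq, fermatShift_apply]; ring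

theorem fermat_eq (p : M) (v : TangentSpace 𝓘(ℝ, E) p) :
    D.fermat p v = D.fermatShift p v + Real.sqrt (D.fermatForm p v v) := by
  rw [fermatForm_self, fermatShift_apply, fermat]

theorem fermatForm_symm (p : M) (v w : TangentSpace 𝓘(ℝ, E) p) :
    D.fermatForm p v w = D.fermatForm p w v := by
  rw [fermatForm_apply, fermatForm_apply, gTilde, gTilde, D.g₀.symm]; ring

theorem gTilde_pos (p : M) {v : TangentSpace 𝓘(ℝ, E) p} (hv : v ≠ 0) : 0 < D.gTilde p v v :=
  div_pos (D.g₀.pos p v hv) (D.β_pos p)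

theorem fermatShift_sq_lt (p : M) {v : TangentSpace 𝓘(ℝ, E) p} (hv : v ≠ 0) :
    D.fermatShift p v ^ 2 < D.fermatForm p v v := by
  rw [fermatForm_apply]
  linarith [D.gTilde_pos p hv]

theorem fermatForm_pos (p : M) {v : TangentSpace 𝓘(ℝ, E) p} (hv : v ≠ 0) :
    0 < D.fermatForm p v v :=
  (sq_nonneg _).trans_lt (D.fermatShift_sq_lt p hv)

/-- Completing the square in the time component; the link between the spacetime metric and the
Fermat metric. -/
theorem normalizedMetric_apply (z : M × ℝ)
    (v w : TangentSpace (𝓘(ℝ, E).prod 𝓘(ℝ, ℝ)) z) :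
    D.normalizedMetric z v w = D.fermatForm z.1 (spacePart z v) (spacePart z w)
      - (timePart z v - D.fermatShift z.1 (spacePart z v))
        * (timePart z w - D.fermatShift z.1 (spacePart z w)) := by
  have hβ := (D.β_pos z.1).ne'
  have : D.normalizedMetric z v w = (D.β z.1)⁻¹ * D.metric z v w := rfl
  rw [this, metric_apply, fermatForm_apply, fermatShift_apply, fermatShift_apply]
  simp only [gTilde]
  field_simp
  ring

/-- The components of `h` in the preferred chart at `p`. -/
def chartForm (p : M) : E → E →L[ℝ] E →L[ℝ] ℝ := D.fermatForm.inChart p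

/-- The components of `g̃₀[δ, ·]` in the preferred chart at `p`. -/
def chartShift (p : M) (a : E) : E →L[ℝ] ℝ :=
  (D.fermatShift ((extChartAt 𝓘(ℝ, E) p).symm a)).comp (chartFrame 𝓘(ℝ, E) p a)

theorem finslerInChart_fermat (p : M) :
    finslerInChart (I := 𝓘(ℝ, E)) D.fermat p = randers (D.chartForm p) (D.chartShift p) := by
  ext a y
  simp only [finslerInChart, fermat_eq]
  rfl

theorem contMDiffOn_inner_chart (p : M)
    {v w : ∀ a : E, TangentSpace 𝓘(ℝ, E) ((extChartAt 𝓘(ℝ, E) p).symm a)} {U : Set E}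
    (hU : U ⊆ (extChartAt 𝓘(ℝ, E) p).target)
    (hv : ContMDiffOn 𝓘(ℝ, E) 𝓘(ℝ, E).tangent ∞
      (fun a => (⟨(extChartAt 𝓘(ℝ, E) p).symm a, v a⟩ : TangentBundle 𝓘(ℝ, E) M)) U)
    (hw : ContMDiffOn 𝓘(ℝ, E) 𝓘(ℝ, E).tangent ∞
      (fun a => (⟨(extChartAt 𝓘(ℝ, E) p).symm a, w a⟩ : TangentBundle 𝓘(ℝ, E) M)) U) :
    ContDiffOn ℝ ∞ (fun a => D.g₀.inner ((extChartAt 𝓘(ℝ, E) p).symm a) (v a) (w a)) U := by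
  intro a ha
  have hb := (contMDiffOn_extChartAt_symm (I := 𝓘(ℝ, E)) (n := ∞) p a (hU ha)).mono hU
  have : ContMDiffWithinAt 𝓘(ℝ, E) (𝓘(ℝ, E).prod 𝓘(ℝ, ℝ)) ∞
      (fun a => TotalSpace.mk' ℝ (E := Bundle.Trivial M ℝ) ((extChartAt 𝓘(ℝ, E) p).symm a)
        (D.g₀.inner ((extChartAt 𝓘(ℝ, E) p).symm a) (v a) (w a))) U a := by
    apply ContMDiffWithinAt.clm_bundle_apply₂ (F₁ := E) (F₂ := E)
    · exact ContMDiffAt.comp_contMDiffWithinAt a D.g₀.contMDiff.contMDiffAt hb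
    · exact hv a ha
    · exact hw a ha
  simp only [contMDiffWithinAt_totalSpace] at this
  exact contMDiffWithinAt_iff_contDiffWithinAt.1 this.2

theorem contDiffOn_inv_β_chart (p : M) :
    ContDiffOn ℝ ∞ (fun a => (D.β ((extChartAt 𝓘(ℝ, E) p).symm a))⁻¹)
      (extChartAt 𝓘(ℝ, E) p).target := by
  have h1 := D.β_smooth.comp_contMDiffOn
    (contMDiffOn_extChartAt_symm (I := 𝓘(ℝ, E)) (n := ∞) p)
  exact (contMDiffOn_iff_contDiffOn.1 h1).inv fun a _ => (D.β_pos _).ne'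

theorem contDiffOn_chartShift_apply (p : M) (u : E) :
    ContDiffOn ℝ ∞ (fun a => D.chartShift p a u) (extChartAt 𝓘(ℝ, E) p).target :=
  (D.contDiffOn_inv_β_chart p).mul (D.contMDiffOn_inner_chart p subset_rfl
    (D.δ_smooth.comp_contMDiffOn (contMDiffOn_extChartAt_symm (I := 𝓘(ℝ, E)) (n := ∞) p))
    (contMDiffOn_chartFrame p u))

theorem contDiffOn_chartShift [FiniteDimensional ℝ E] (p : M) :
    ContDiffOn ℝ ∞ (D.chartShift p) (extChartAt 𝓘(ℝ, E) p).target :=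
  contDiffOn_clm_apply.2 (D.contDiffOn_chartShift_apply p)

theorem contDiffOn_chartForm [FiniteDimensional ℝ E] (p : M) :
    ContDiffOn ℝ ∞ (D.chartForm p) (extChartAt 𝓘(ℝ, E) p).target :=
  contDiffOn_clm_apply.2 fun u => contDiffOn_clm_apply.2 fun v =>
    ((D.contDiffOn_inv_β_chart p).mul (D.contMDiffOn_inner_chart p subset_rfl
      (contMDiffOn_chartFrame p u) (contMDiffOn_chartFrame p v))).add
    ((D.contDiffOn_chartShift_apply p u).mul (D.contDiffOn_chartShift_apply p v))

/-- The bound `θ² < h` is the positivity of `h - θ² = g̃₀`; injectivity of the frame carries the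
pointwise inequalities to coordinates. -/
theorem isRandersField [FiniteDimensional ℝ E] (p : M) :
    IsRandersField (D.chartForm p) (D.chartShift p) (extChartAt 𝓘(ℝ, E) p).target where
  isOpen := isOpen_extChartAt_target p
  contDiffOn_form := (D.contDiffOn_chartForm p).of_le (by simp)
  contDiffOn_shift := (D.contDiffOn_chartShift p).of_le (by simp)
  isRandersPair a ha :=
    { symm := fun u v => D.fermatForm_symm _ _ _
      pos := fun u hu => D.fermatForm_pos _ fun h => hu (chartFrame_injective ha h)
      sq_lt := fun u hu => D.fermatShift_sq_lt _ fun h => hu (chartFrame_injective ha h) }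

omit [IsManifold 𝓘(ℝ, E) ∞ M] in
theorem extChartAt_prod_symm (z : M × ℝ) :
    ⇑(extChartAt (𝓘(ℝ, E).prod 𝓘(ℝ, ℝ)) z).symm
      = fun q : E × ℝ => ((extChartAt 𝓘(ℝ, E) z.1).symm q.1, q.2) := by
  rfl

theorem chartFrame_prod (z : M × ℝ) {q : E × ℝ} (hq : q.1 ∈ (extChartAt 𝓘(ℝ, E) z.1).target)
    (u : E × ℝ) :
    (chartFrame (𝓘(ℝ, E).prod 𝓘(ℝ, ℝ)) z q u : E × ℝ)
      = ((chartFrame 𝓘(ℝ, E) z.1 q.1 u.1 : E), u.2) := by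
  have h1 : HasMFDerivAt 𝓘(ℝ, E) 𝓘(ℝ, E) (extChartAt 𝓘(ℝ, E) z.1).symm q.1
      (chartFrame 𝓘(ℝ, E) z.1 q.1) := by
    have := (mdifferentiableWithinAt_extChartAt_symm (I := 𝓘(ℝ, E)) hq).hasMFDerivWithinAt
    unfold chartFrame
    rw [← hasMFDerivWithinAt_univ, ← ModelWithCorners.range_eq_univ 𝓘(ℝ, E)]
    exact this
  have hfst : HasMFDerivAt 𝓘(ℝ, E × ℝ) 𝓘(ℝ, E) (Prod.fst : E × ℝ → E) q
    (ContinuousLinearMap.fst ℝ E ℝ) := hasFDerivAt_fst.hasMFDerivAt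
  have hsnd : HasMFDerivAt 𝓘(ℝ, E × ℝ) 𝓘(ℝ, ℝ) (Prod.snd : E × ℝ → ℝ) q
    (ContinuousLinearMap.snd ℝ E ℝ) := hasFDerivAt_snd.hasMFDerivAt
  have h3 := (HasMFDerivAt.comp q h1 hfst).prodMk hsnd
  have h5 : (chartFrame (𝓘(ℝ, E).prod 𝓘(ℝ, ℝ)) z q : E × ℝ →L[ℝ] E × ℝ) =
      mfderiv 𝓘(ℝ, E × ℝ) (𝓘(ℝ, E).prod 𝓘(ℝ, ℝ))
        (extChartAt (𝓘(ℝ, E).prod 𝓘(ℝ, ℝ)) z).symm q := by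
    unfold chartFrame
    rw [ModelWithCorners.range_eq_univ, mfderivWithin_univ]
  rw [h5, extChartAt_prod_symm]
  exact congrArg (fun f : E × ℝ →L[ℝ] E × ℝ => f u) h3.mfderiv

theorem inChart_normalizedMetric (z : M × ℝ) {q : E × ℝ}
    (hq : q.1 ∈ (extChartAt 𝓘(ℝ, E) z.1).target) :
    D.normalizedMetric.inChart z q = stationaryForm (D.chartForm z.1) (D.chartShift z.1) q := by
  refine ContinuousLinearMap.ext fun u => ContinuousLinearMap.ext fun v => ?_
  have hu := chartFrame_prod z hq u
  have hv := chartFrame_prod z hq v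
  have h1 : (extChartAt (𝓘(ℝ, E).prod 𝓘(ℝ, ℝ)) z).symm q
      = ((extChartAt 𝓘(ℝ, E) z.1).symm q.1, q.2) := by
    rw [extChartAt_prod_symm]
  -- Base point and vectors are generalized together so that the substitution is type-correct.
  have key : ∀ (z' : M × ℝ) (u' v' : E × ℝ), z' = ((extChartAt 𝓘(ℝ, E) z.1).symm q.1, q.2) →
      u' = ((chartFrame 𝓘(ℝ, E) z.1 q.1 u.1 : E), u.2) →
      v' = ((chartFrame 𝓘(ℝ, E) z.1 q.1 v.1 : E), v.2) →
      D.normalizedMetric z' u' v'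
        = stationaryForm (D.chartForm z.1) (D.chartShift z.1) q u v := by
    rintro _ _ _ rfl rfl rfl
    exact D.normalizedMetric_apply _ _ _
  exact key _ _ _ h1 hu hv

end StandardStationary

/-! ### Both geodesic equations along a curve of the manifold. -/

namespace StandardStationary

variable {E : Type*} [NormedAddCommGroup E] [NormedSpace ℝ E]
  {M : Type*} [TopologicalSpace M] [ChartedSpace E M] [IsManifold 𝓘(ℝ, E) ∞ M]
  (D : StandardStationary (E := E) M) {x : ℝ → M} {t : ℝ → ℝ} {S : Set ℝ} {r s : ℝ} {p : M}

theorem fermatShift_velocity (hx : ContMDiffWithinAt 𝓘(ℝ, ℝ) 𝓘(ℝ, E) ∞ x S r)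
    (hS : UniqueDiffWithinAt ℝ S r) (hp : x r ∈ (extChartAt 𝓘(ℝ, E) p).source) :
    D.fermatShift (x r) (velocity 𝓘(ℝ, E) x S r)
      = D.chartShift p (chartCurve 𝓘(ℝ, E) p x r)
        (derivWithin (chartCurve 𝓘(ℝ, E) p x) S r) := by
  rw [← chartVec_velocity hx hS hp]
  exact (frame_chartVec (fun q v => D.fermatShift q v) hp _).symm

theorem fermatForm_velocity (hx : ContMDiffWithinAt 𝓘(ℝ, ℝ) 𝓘(ℝ, E) ∞ x S r)
    (hS : UniqueDiffWithinAt ℝ S r) (hp : x r ∈ (extChartAt 𝓘(ℝ, E) p).source) :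
    D.fermatForm (x r) (velocity 𝓘(ℝ, E) x S r) (velocity 𝓘(ℝ, E) x S r)
      = D.chartForm p (chartCurve 𝓘(ℝ, E) p x r)
        (derivWithin (chartCurve 𝓘(ℝ, E) p x) S r)
        (derivWithin (chartCurve 𝓘(ℝ, E) p x) S r) := by
  rw [← chartVec_velocity hx hS hp]
  exact (frame_chartVec (fun q v => D.fermatForm q v v) hp _).symm

section

variable (hx : ContMDiffOn 𝓘(ℝ, ℝ) 𝓘(ℝ, E) ∞ x S) (hS : UniqueDiffOn ℝ S) (hs : s ∈ S)

include hx hs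

theorem contDiffWithinAt_derivWithin_chartCurve (hS : UniqueDiffOn ℝ S) :
    ContDiffWithinAt ℝ ∞ (derivWithin (chartCurve 𝓘(ℝ, E) (x s) x) S) S s :=
  (contDiffWithinAt_chartCurve (hx s hs) (mem_extChartAt_source (x s))).derivWithin hS
    (by simp) hs

theorem hasDerivWithinAt_chartCurve :
    HasDerivWithinAt (chartCurve 𝓘(ℝ, E) (x s) x)
      (derivWithin (chartCurve 𝓘(ℝ, E) (x s) x) S s) S s :=
  ((contDiffWithinAt_chartCurve (hx s hs)
    (mem_extChartAt_source (x s))).differentiableWithinAt (by simp)).hasDerivWithinAt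

include hS

theorem hasDerivWithinAt_derivWithin_chartCurve :
    HasDerivWithinAt (derivWithin (chartCurve 𝓘(ℝ, E) (x s) x) S)
      (derivWithin (derivWithin (chartCurve 𝓘(ℝ, E) (x s) x) S) S s) S s :=
  ((contDiffWithinAt_derivWithin_chartCurve hx hs hS).differentiableWithinAt
    (by simp)).hasDerivWithinAt

theorem fermatShift_velocity_eventuallyEq :
    (fun r => D.fermatShift (x r) (velocity 𝓘(ℝ, E) x S r)) =ᶠ[𝓝[S] s]
      fun r => D.chartShift (x s) (chartCurve 𝓘(ℝ, E) (x s) x r)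
        (derivWithin (chartCurve 𝓘(ℝ, E) (x s) x) S r) := by
  filter_upwards [eventually_mem_source (hx s hs).continuousWithinAt
    (mem_extChartAt_source (I := 𝓘(ℝ, E)) (x s)), self_mem_nhdsWithin] with r hr hrS
  exact D.fermatShift_velocity (hx r hrS) (hS r hrS) hr

theorem fermatForm_velocity_eventuallyEq :
    (fun r => D.fermatForm (x r) (velocity 𝓘(ℝ, E) x S r) (velocity 𝓘(ℝ, E) x S r)) =ᶠ[𝓝[S] s]
      fun r => D.chartForm (x s) (chartCurve 𝓘(ℝ, E) (x s) x r)
        (derivWithin (chartCurve 𝓘(ℝ, E) (x s) x) S r)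
        (derivWithin (chartCurve 𝓘(ℝ, E) (x s) x) S r) := by
  filter_upwards [eventually_mem_source (hx s hs).continuousWithinAt
    (mem_extChartAt_source (I := 𝓘(ℝ, E)) (x s)), self_mem_nhdsWithin] with r hr hrS
  exact D.fermatForm_velocity (hx r hrS) (hS r hrS) hr

theorem derivWithin_chartCurve_ne_zero (hv : velocity 𝓘(ℝ, E) x S s ≠ 0) :
    derivWithin (chartCurve 𝓘(ℝ, E) (x s) x) S s ≠ 0 := by
  intro h0
  rw [← chartVec_velocity (hx s hs) (hS s hs) (mem_extChartAt_source (x s))] at h0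
  have h1 := frame_chartVec (fun q v => v = (0 : TangentSpace 𝓘(ℝ, E) q))
    (mem_extChartAt_source (I := 𝓘(ℝ, E)) (x s)) (velocity 𝓘(ℝ, E) x S s)
  simp only [h0, map_zero, eq_iff_iff, true_iff] at h1
  exact hv h1

omit [IsManifold 𝓘(ℝ, E) ∞ M] in
theorem velocity_prodMk (ht : ContDiffOn ℝ ∞ t S) :
    (velocity (𝓘(ℝ, E).prod 𝓘(ℝ, ℝ)) (fun s => (x s, t s)) S s : E × ℝ)
      = ((velocity 𝓘(ℝ, E) x S s : E), derivWithin t S s) := by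
  have h1 := mfderivWithin_prodMk (I := 𝓘(ℝ, ℝ)) (I' := 𝓘(ℝ, E)) (I'' := 𝓘(ℝ, ℝ))
    ((hx s hs).mdifferentiableWithinAt (by simp))
    ((ht s hs).contMDiffWithinAt.mdifferentiableWithinAt (by simp)) (hS s hs).uniqueMDiffWithinAt
  have h2 := congrArg (fun f : ℝ →L[ℝ] E × ℝ => f 1) h1
  have h3 : (mfderivWithin 𝓘(ℝ, ℝ) 𝓘(ℝ, ℝ) t S s : ℝ →L[ℝ] ℝ) 1 = derivWithin t S s := by
    rw [mfderivWithin_eq_fderivWithin]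
    exact fderivWithin_derivWithin
  rw [← h3]
  exact h2

theorem normalizedMetric_velocity_self (ht : ContDiffOn ℝ ∞ t S) :
    D.normalizedMetric (x s, t s) (velocity (𝓘(ℝ, E).prod 𝓘(ℝ, ℝ)) (fun s => (x s, t s)) S s)
        (velocity (𝓘(ℝ, E).prod 𝓘(ℝ, ℝ)) (fun s => (x s, t s)) S s)
      = D.hSq (x s) (velocity 𝓘(ℝ, E) x S s)
        - (derivWithin t S s - D.fermatShift (x s) (velocity 𝓘(ℝ, E) x S s)) ^ 2 := by
  have h1 := velocity_prodMk hx hS hs ht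
  have key : ∀ u : E × ℝ, u = ((velocity 𝓘(ℝ, E) x S s : E), derivWithin t S s) →
      D.normalizedMetric (x s, t s) u u = D.hSq (x s) (velocity 𝓘(ℝ, E) x S s)
        - (derivWithin t S s - D.fermatShift (x s) (velocity 𝓘(ℝ, E) x S s)) ^ 2 := by
    rintro _ rfl
    rw [sq, ← fermatForm_self]
    exact D.normalizedMetric_apply _ _ _
  exact key _ h1

theorem normalizedMetric_velocity_timeField (ht : ContDiffOn ℝ ∞ t S) :
    D.normalizedMetric (x s, t s) (velocity (𝓘(ℝ, E).prod 𝓘(ℝ, ℝ)) (fun s => (x s, t s)) S s)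
        (timeField (x s, t s))
      = -(derivWithin t S s - D.fermatShift (x s) (velocity 𝓘(ℝ, E) x S s)) := by
  have h1 := velocity_prodMk hx hS hs ht
  have key : ∀ u : E × ℝ, u = ((velocity 𝓘(ℝ, E) x S s : E), derivWithin t S s) →
      D.normalizedMetric (x s, t s) u (timeField (x s, t s)) =
        -(derivWithin t S s - D.fermatShift (x s) (velocity 𝓘(ℝ, E) x S s)) := by
    rintro _ rfl
    refine (D.normalizedMetric_apply _ _ _).trans ?_
    have e1 : spacePart (E := E) (x s, t s) (timeField (x s, t s)) = 0 := rfl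
    have e2 : timePart (E := E) (x s, t s) (timeField (x s, t s)) = 1 := rfl
    rw [e1, e2, map_zero, map_zero, sub_zero, mul_one, zero_sub]
    rfl
  exact key _ h1

variable [FiniteDimensional ℝ E]

theorem contDiffWithinAt_fermatShift_velocity :
    ContDiffWithinAt ℝ ∞ (fun r => D.fermatShift (x r) (velocity 𝓘(ℝ, E) x S r)) S s := by
  refine ContDiffWithinAt.congr_of_eventuallyEq_of_mem ?_
    (D.fermatShift_velocity_eventuallyEq hx hS hs) hs
  have h1 : ContDiffAt ℝ ∞ (D.chartShift (x s)) (chartCurve 𝓘(ℝ, E) (x s) x s) :=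
    (D.contDiffOn_chartShift (x s)).contDiffAt (extChartAt_target_mem_nhds (x s))
  exact (h1.comp_contDiffWithinAt s (contDiffWithinAt_chartCurve (hx s hs)
    (mem_extChartAt_source (x s)))).clm_apply (contDiffWithinAt_derivWithin_chartCurve hx hs hS)

theorem hasDerivWithinAt_fermatShift_velocity :
    HasDerivWithinAt (fun r => D.fermatShift (x r) (velocity 𝓘(ℝ, E) x S r))
      (fderiv ℝ (D.chartShift (x s)) (chartCurve 𝓘(ℝ, E) (x s) x s)
          (derivWithin (chartCurve 𝓘(ℝ, E) (x s) x) S s)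
          (derivWithin (chartCurve 𝓘(ℝ, E) (x s) x) S s)
        + D.chartShift (x s) (chartCurve 𝓘(ℝ, E) (x s) x s)
          (derivWithin (derivWithin (chartCurve 𝓘(ℝ, E) (x s) x) S) S s)) S s := by
  refine HasDerivWithinAt.congr_of_eventuallyEq_of_mem ?_
    (D.fermatShift_velocity_eventuallyEq hx hS hs) hs
  exact (D.isRandersField (x s)).hasDerivWithinAt_shift (mem_extChartAt_target (x s))
    (hasDerivWithinAt_chartCurve hx hs) (hasDerivWithinAt_derivWithin_chartCurve hx hS hs)

theorem hasDerivWithinAt_fermatForm_velocity :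
    HasDerivWithinAt
      (fun r => D.fermatForm (x r) (velocity 𝓘(ℝ, E) x S r) (velocity 𝓘(ℝ, E) x S r))
      (fderiv ℝ (D.chartForm (x s)) (chartCurve 𝓘(ℝ, E) (x s) x s)
          (derivWithin (chartCurve 𝓘(ℝ, E) (x s) x) S s)
          (derivWithin (chartCurve 𝓘(ℝ, E) (x s) x) S s)
          (derivWithin (chartCurve 𝓘(ℝ, E) (x s) x) S s)
        + 2 * D.chartForm (x s) (chartCurve 𝓘(ℝ, E) (x s) x s)
          (derivWithin (chartCurve 𝓘(ℝ, E) (x s) x) S s)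
          (derivWithin (derivWithin (chartCurve 𝓘(ℝ, E) (x s) x) S) S s)) S s := by
  refine HasDerivWithinAt.congr_of_eventuallyEq_of_mem ?_
    (D.fermatForm_velocity_eventuallyEq hx hS hs) hs
  exact (D.isRandersField (x s)).hasDerivWithinAt_form (mem_extChartAt_target (x s))
    (hasDerivWithinAt_chartCurve hx hs) (hasDerivWithinAt_derivWithin_chartCurve hx hS hs)

/-- The Fermat geodesic equation along a curve of constant `h`-speed, in coordinates. -/
theorem chernAlong_fermat_eq_zero_iff (hv : ∀ r ∈ S, velocity 𝓘(ℝ, E) x S r ≠ 0) {c : ℝ}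
    (hc : ∀ r ∈ S, D.hSq (x r) (velocity 𝓘(ℝ, E) x S r) = c) :
    chernAlong D.fermat x S
        (fun r => (D.fermat (x r) (velocity 𝓘(ℝ, E) x S r))⁻¹ • velocity 𝓘(ℝ, E) x S r) s = 0 ↔
      ∀ w, eulerLagrange (D.chartForm (x s)) (D.chartShift (x s)) (Real.sqrt c)
        (chartCurve 𝓘(ℝ, E) (x s) x s) (derivWithin (chartCurve 𝓘(ℝ, E) (x s) x) S s)
        (derivWithin (derivWithin (chartCurve 𝓘(ℝ, E) (x s) x) S) S s) w = 0 := by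
  have hp := mem_extChartAt_source (I := 𝓘(ℝ, E)) (x s)
  have ht := mem_extChartAt_target (I := 𝓘(ℝ, E)) (x s)
  have H := D.isRandersField (x s)
  have hy := derivWithin_chartCurve_ne_zero hx hS hs (hv s hs)
  have hcs : D.chartForm (x s) (chartCurve 𝓘(ℝ, E) (x s) x s)
      (derivWithin (chartCurve 𝓘(ℝ, E) (x s) x) S s)
      (derivWithin (chartCurve 𝓘(ℝ, E) (x s) x) S s) = c := by
    rw [← D.fermatForm_velocity (hx s hs) (hS s hs) hp, fermatForm_self, hc s hs]
  -- Differentiating the constant `h(ẋ, ẋ)`; uniqueness of derivatives within `S` covers one-sided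
  -- ones.
  have hconst := (hS s hs).eq_deriv _ (D.hasDerivWithinAt_fermatForm_velocity hx hS hs)
    ((hasDerivWithinAt_const s S c).congr (fun r hr => by rw [fermatForm_self, hc r hr])
      (by rw [fermatForm_self, hc s hs]))
  have hFs : D.fermat (x s) (velocity 𝓘(ℝ, E) x S s)
      = randers (D.chartForm (x s)) (D.chartShift (x s)) (chartCurve 𝓘(ℝ, E) (x s) x s)
        (derivWithin (chartCurve 𝓘(ℝ, E) (x s) x) S s) := by
    rw [fermat_eq, D.fermatForm_velocity (hx s hs) (hS s hs) hp,
      D.fermatShift_velocity (hx s hs) (hS s hs) hp, randers]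
  have hF := randers_pos (H.isRandersPair _ ht) hy
  -- On `S` one has `F = θ(ẋ) + √c`, so only `θ(ẋ)` contributes to the derivative.
  have hFd : HasDerivWithinAt (fun r => D.fermat (x r) (velocity 𝓘(ℝ, E) x S r)) _ S s :=
    ((D.hasDerivWithinAt_fermatShift_velocity hx hS hs).add_const (Real.sqrt c)).congr
      (fun r hr => by rw [fermat_eq, fermatForm_self, hc r hr])
      (by rw [fermat_eq, fermatForm_self, hc s hs])
  have hne : D.fermat (x s) (velocity 𝓘(ℝ, E) x S s) ≠ 0 := by rw [hFs]; exact hF.ne'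
  have hW := (hFd.inv hne).smul (hasDerivWithinAt_derivWithin_chartCurve hx hS hs)
  have e : (fun r => chartVec 𝓘(ℝ, E) (x s) (x r)
        ((D.fermat (x r) (velocity 𝓘(ℝ, E) x S r))⁻¹ • velocity 𝓘(ℝ, E) x S r)) =ᶠ[𝓝[S] s]
      (fun r => D.fermat (x r) (velocity 𝓘(ℝ, E) x S r))⁻¹
        • derivWithin (chartCurve 𝓘(ℝ, E) (x s) x) S := by
    filter_upwards [eventually_mem_source (hx s hs).continuousWithinAt hp,
      self_mem_nhdsWithin] with r hr hrS
    have : chartVec 𝓘(ℝ, E) (x s) (x r)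
        ((D.fermat (x r) (velocity 𝓘(ℝ, E) x S r))⁻¹ • velocity 𝓘(ℝ, E) x S r)
        = (D.fermat (x r) (velocity 𝓘(ℝ, E) x S r))⁻¹ •
          chartVec 𝓘(ℝ, E) (x s) (x r) (velocity 𝓘(ℝ, E) x S r) := map_smul _ _ _
    rw [this, chartVec_velocity (hx r hrS) (hS r hrS) hr]
    rfl
  have hsm : chartVec 𝓘(ℝ, E) (x s) (x s)
        ((D.fermat (x s) (velocity 𝓘(ℝ, E) x S s))⁻¹ • velocity 𝓘(ℝ, E) x S s)
        = (D.fermat (x s) (velocity 𝓘(ℝ, E) x S s))⁻¹ •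
          derivWithin (chartCurve 𝓘(ℝ, E) (x s) x) S s := by
    rw [← chartVec_velocity (hx s hs) (hS s hs) hp]
    exact map_smul _ _ _
  have key := H.geodesic_equation_iff ht hy
    (derivWithin (derivWithin (chartCurve 𝓘(ℝ, E) (x s) x) S) S s) hconst
  rw [show extChartAt 𝓘(ℝ, E) (x s) (x s) = chartCurve 𝓘(ℝ, E) (x s) x s from rfl, hcs] at key
  rw [← key]
  unfold chernAlong
  rw [e.derivWithin_eq_of_mem hs, hW.derivWithin (hS s hs), hsm,
    chartVec_velocity (hx s hs) (hS s hs) hp, finslerInChart_fermat, ← hFs]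
  rfl

variable (ht : ContDiffOn ℝ ∞ t S)

include ht

/-- The geodesic equation of `g / β` in coordinates. -/
theorem leviCivitaAlong_eq_zero_iff :
    leviCivitaAlong D.normalizedMetric (fun s => (x s, t s)) S
        (velocity (𝓘(ℝ, E).prod 𝓘(ℝ, ℝ)) (fun s => (x s, t s)) S) s = 0 ↔
      HasDerivWithinAt
        (fun r => derivWithin t S r - D.fermatShift (x r) (velocity 𝓘(ℝ, E) x S r)) 0 S s ∧
      ∀ w, eulerLagrange (D.chartForm (x s)) (D.chartShift (x s))
        (derivWithin t S s - D.fermatShift (x s) (velocity 𝓘(ℝ, E) x S s))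
        (chartCurve 𝓘(ℝ, E) (x s) x s) (derivWithin (chartCurve 𝓘(ℝ, E) (x s) x) S s)
        (derivWithin (derivWithin (chartCurve 𝓘(ℝ, E) (x s) x) S) S s) w = 0 := by
  have hp := mem_extChartAt_source (I := 𝓘(ℝ, E)) (x s)
  have hz := hx.prodMk ht.contMDiffOn
  have H := D.isRandersField (x s)
  rw [leviCivitaAlong_velocity _ hS hz hs]
  have e0 : chartCurve (𝓘(ℝ, E).prod 𝓘(ℝ, ℝ)) (x s, t s) (fun s => (x s, t s))
      = fun r => (chartCurve 𝓘(ℝ, E) (x s) x r, t r) := rfl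
  have hc : ∀ r ∈ S, x r ∈ (extChartAt 𝓘(ℝ, E) (x s)).source →
      derivWithin (fun r => (chartCurve 𝓘(ℝ, E) (x s) x r, t r)) S r
        = (derivWithin (chartCurve 𝓘(ℝ, E) (x s) x) S r, derivWithin t S r) := by
    intro r hrS hr
    exact ((((contDiffWithinAt_chartCurve (hx r hrS) hr).differentiableWithinAt
      (by simp)).hasDerivWithinAt).prodMk ((ht r hrS).differentiableWithinAt
      (by simp)).hasDerivWithinAt).derivWithin (hS r hrS)
  have e1 : derivWithin (fun r => (chartCurve 𝓘(ℝ, E) (x s) x r, t r)) S =ᶠ[𝓝[S] s]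
      fun r => (derivWithin (chartCurve 𝓘(ℝ, E) (x s) x) S r, derivWithin t S r) := by
    filter_upwards [eventually_mem_source (hx s hs).continuousWithinAt hp,
      self_mem_nhdsWithin] with r hr hrS
    exact hc r hrS hr
  have ht' : HasDerivWithinAt (derivWithin t S) (derivWithin (derivWithin t S) S s) S s :=
    (((ht s hs).derivWithin hS (m := ∞) (by simp) hs).differentiableWithinAt
      (by simp)).hasDerivWithinAt
  have e2 : derivWithin (fun r => (derivWithin (chartCurve 𝓘(ℝ, E) (x s) x) S r,
        derivWithin t S r)) S s
      = (derivWithin (derivWithin (chartCurve 𝓘(ℝ, E) (x s) x) S) S s,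
        derivWithin (derivWithin t S) S s) :=
    ((hasDerivWithinAt_derivWithin_chartCurve hx hS hs).prodMk ht').derivWithin (hS s hs)
  -- Agreement on a neighbourhood is needed because the Christoffel symbols contain the derivative
  -- of the metric.
  have e3 : D.normalizedMetric.inChart (x s, t s) =ᶠ[𝓝 (chartCurve 𝓘(ℝ, E) (x s) x s, t s)]
      stationaryForm (D.chartForm (x s)) (D.chartShift (x s)) := by
    have : Prod.fst ⁻¹' (extChartAt 𝓘(ℝ, E) (x s)).target
        ∈ 𝓝 (chartCurve 𝓘(ℝ, E) (x s) x s, t s) :=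
      (H.isOpen.preimage continuous_fst).mem_nhds (mem_extChartAt_target (x s))
    filter_upwards [this] with q hq
    exact D.inChart_normalizedMetric (x s, t s) hq
  have e4 : leviCivitaSymbol D.normalizedMetric (x s, t s)
      (extChartAt (𝓘(ℝ, E).prod 𝓘(ℝ, ℝ)) (x s, t s) (x s, t s))
      = christoffel (stationaryForm (D.chartForm (x s)) (D.chartShift (x s))
          (chartCurve 𝓘(ℝ, E) (x s) x s, t s))
        (fderiv ℝ (stationaryForm (D.chartForm (x s)) (D.chartShift (x s)))
          (chartCurve 𝓘(ℝ, E) (x s) x s, t s)) := by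
    change christoffel (D.normalizedMetric.inChart (x s, t s)
      (chartCurve 𝓘(ℝ, E) (x s) x s, t s)) (fderiv ℝ (D.normalizedMetric.inChart (x s, t s))
      (chartCurve 𝓘(ℝ, E) (x s) x s, t s)) = _
    rw [e3.fderiv_eq, e3.eq_of_nhds]
  rw [e0, e1.derivWithin_eq_of_mem hs, e2, hc s hs hp, e4, H.stationary_geodesic_equation_iff
    (q := (chartCurve 𝓘(ℝ, E) (x s) x s, t s)) (mem_extChartAt_target (x s))]
  simp only
  rw [D.fermatShift_velocity (hx s hs) (hS s hs) hp]
  refine and_congr ?_ Iff.rfl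
  -- The time component of the geodesic equation is exactly the derivative of `ṫ - θ(ẋ)`.
  have hd := ht'.sub (D.hasDerivWithinAt_fermatShift_velocity hx hS hs)
  constructor
  · intro h0
    refine hd.congr_deriv ?_
    rw [← h0]; ring
  · intro h0
    rw [← (hS s hs).eq_deriv _ hd h0]; ring

end

end StandardStationary
-- Integral formulas on a closed interval.
theorem eq_add_integral_of_derivWithin_Icc {t f : ℝ → ℝ} {a b : ℝ}
    (ht : ContinuousOn t (Icc a b)) (hf : ContinuousOn f (Icc a b))
    (hd : ∀ r ∈ Ioo a b, HasDerivAt t (f r) r) :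
    ∀ s ∈ Icc a b, t s = t a + ∫ v in a..s, f v := by
  intro s hs
  have hsub : Icc a s ⊆ Icc a b := Icc_subset_Icc_right hs.2
  rw [intervalIntegral.integral_eq_sub_of_hasDerivAt_of_le hs.1 (ht.mono hsub)
    (fun r hr => hd r (Ioo_subset_Ioo_right hs.2 hr))
    ((hf.mono hsub).intervalIntegrable_of_Icc hs.1)]
  ring

theorem hasDerivWithinAt_of_eq_integral {t f : ℝ → ℝ} {a b t₀ : ℝ} (hab : a ≤ b)
    (hf : ContinuousOn f (Icc a b)) (ht : ∀ s ∈ Icc a b, t s = t₀ + ∫ v in a..s, f v)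
    {s : ℝ} (hs : s ∈ Icc a b) : HasDerivWithinAt t (f s) (Icc a b) s := by
  -- Extending `f` by its end values makes it continuous on the whole line, so the end points need
  -- no separate argument.
  have hg : Continuous (IccExtend hab ((Icc a b).domRestrict f)) := hf.domRestrict.Icc_extend'
  have hgf : ∀ r ∈ Icc a b, IccExtend hab ((Icc a b).domRestrict f) r = f r := fun r hr =>
    IccExtend_of_mem hab _ hr
  have h1 := ((hg.integral_hasStrictDerivAt a s).hasDerivAt.const_add t₀).hasDerivWithinAt
    (s := Icc a b)
  rw [hgf s hs] at h1
  have h2 : ∀ r ∈ Icc a b, t r = t₀ + ∫ v in a..r, IccExtend hab ((Icc a b).domRestrict f) v := by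
    intro r hr
    rw [ht r hr]
    congr 1
    refine intervalIntegral.integral_congr fun v hv => ?_
    rw [uIcc_of_le hr.1] at hv
    exact (hgf v ⟨hv.1, hv.2.trans hr.2⟩).symm
  exact h1.congr h2 (h2 s hs)

theorem contDiffOn_infty_of_hasDerivWithinAt {t f : ℝ → ℝ} {S : Set ℝ} (hS : UniqueDiffOn ℝ S)
    (hf : ContDiffOn ℝ ∞ f S) (ht : ∀ s ∈ S, HasDerivWithinAt t (f s) S s) :
    ContDiffOn ℝ ∞ t S :=
  (contDiffOn_infty_iff_derivWithin hS).2
    ⟨fun s hs => (ht s hs).differentiableWithinAt,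
      hf.congr fun s hs => (ht s hs).derivWithin (hS s hs)⟩

end FermatPrinciple

end

/-! ### Fermat's principle. -/

open FermatPrinciple StandardStationary in
theorem mainTheorem5
    {E : Type*} [NormedAddCommGroup E] [NormedSpace ℝ E] [FiniteDimensional ℝ E]
    {M : Type*} [TopologicalSpace M] [ChartedSpace E M] [IsManifold 𝓘(ℝ, E) ∞ M]
    (D : FermatPrinciple.StandardStationary (E := E) M)
    (x₀ x₁ : M) (t₀ : ℝ) (x : ℝ → M) (t : ℝ → ℝ)
    (hx₀ : x 0 = x₀) (ht₀ : t 0 = t₀) (hx₁ : x 1 = x₁) :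
    (FermatPrinciple.IsLightlikeGeodesicOn D.normalizedMetric
          (fun s => (x s, t s)) (Icc 0 1) ∧
        FermatPrinciple.IsFuturePointingOn D.normalizedMetric
          FermatPrinciple.StandardStationary.timeField (fun s => (x s, t s)) (Icc 0 1)) ↔
      (FermatPrinciple.IsFinslerGeodesicOn (I := 𝓘(ℝ, E)) D.fermat x (Icc 0 1) ∧
        (∃ c : ℝ, ∀ s ∈ Icc (0 : ℝ) 1,
          D.hSq (x s) (FermatPrinciple.velocity 𝓘(ℝ, E) x (Icc 0 1) s) = c) ∧
        ∀ s ∈ Icc (0 : ℝ) 1, t s = t₀ + ∫ v in (0 : ℝ)..s,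
          D.fermat (x v) (FermatPrinciple.velocity 𝓘(ℝ, E) x (Icc 0 1) v)) := by
  have hS : UniqueDiffOn ℝ (Icc (0 : ℝ) 1) := uniqueDiffOn_Icc zero_lt_one
  constructor
  · rintro ⟨⟨⟨hz, hgeo⟩, hnull⟩, hfut⟩
    have hx : ContMDiffOn 𝓘(ℝ, ℝ) 𝓘(ℝ, E) ∞ x (Icc 0 1) := contMDiff_fst.comp_contMDiffOn hz
    have ht : ContDiffOn ℝ ∞ t (Icc 0 1) :=
      contMDiffOn_iff_contDiffOn.1 (contMDiff_snd.comp_contMDiffOn hz)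
    have hgeo' := fun s hs => (D.leviCivitaAlong_eq_zero_iff hx hS hs ht).1 (hgeo s hs)
    -- The conserved quantity `-(g/β)[ż, ∂_t]`.
    set ℓ : ℝ → ℝ := fun r =>
      derivWithin t (Icc 0 1) r - D.fermatShift (x r) (velocity 𝓘(ℝ, E) x (Icc 0 1) r) with hℓ
    have hpos : ∀ s ∈ Icc (0 : ℝ) 1, 0 < ℓ s := fun s hs => by
      have := hfut s hs
      rw [D.normalizedMetric_velocity_timeField hx hS hs ht] at this
      exact neg_lt_zero.1 this
    have hconst : ∀ s ∈ Icc (0 : ℝ) 1, ℓ s = ℓ 0 :=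
      constant_of_derivWithin_zero (fun s hs => (hgeo' s hs).1.differentiableWithinAt)
        fun s hs => (hgeo' s (Ico_subset_Icc_self hs)).1.derivWithin
          (hS s (Ico_subset_Icc_self hs))
    have hsq : ∀ s ∈ Icc (0 : ℝ) 1,
        D.hSq (x s) (velocity 𝓘(ℝ, E) x (Icc 0 1) s) = ℓ 0 ^ 2 := fun s hs => by
      have := (hnull s hs).2
      rw [D.normalizedMetric_velocity_self hx hS hs ht] at this
      rw [← hconst s hs]
      exact sub_eq_zero.1 this
    have h0 : 0 < ℓ 0 := hpos 0 (by simp)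
    have hsqrt : Real.sqrt (ℓ 0 ^ 2) = ℓ 0 := Real.sqrt_sq h0.le
    -- Regularity of `x` comes from `h(ẋ, ẋ) = ℓ² > 0`.
    have hv : ∀ s ∈ Icc (0 : ℝ) 1, velocity 𝓘(ℝ, E) x (Icc 0 1) s ≠ 0 := fun s hs hv0 => by
      have := hsq s hs
      rw [hv0, ← fermatForm_self, map_zero] at this
      exact (pow_pos h0 2).ne this
    have hF : ∀ s ∈ Icc (0 : ℝ) 1, D.fermat (x s) (velocity 𝓘(ℝ, E) x (Icc 0 1) s)
        = derivWithin t (Icc 0 1) s := fun s hs => by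
      rw [fermat_eq, fermatForm_self, hsq s hs, hsqrt, ← hconst s hs, hℓ]
      ring
    refine ⟨⟨hx, hv, fun s hs => ?_⟩, ⟨ℓ 0 ^ 2, hsq⟩, ?_⟩
    · rw [D.chernAlong_fermat_eq_zero_iff hx hS hs hv hsq, hsqrt, ← hconst s hs]
      exact (hgeo' s hs).2
    · rw [← ht₀]
      refine eq_add_integral_of_derivWithin_Icc ht.continuousOn
        ((ht.continuousOn_derivWithin hS (by simp)).congr hF) fun s hs => ?_
      rw [hF s (Ioo_subset_Icc_self hs)]
      exact ((ht.differentiableOn (by simp)) s (Ioo_subset_Icc_self hs)).hasDerivWithinAt.hasDerivAt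
        (Icc_mem_nhds hs.1 hs.2)
  · rintro ⟨⟨hx, hv, hgeo⟩, ⟨c, hc⟩, hint⟩
    have hcpos : 0 < c := by
      rw [← hc 0 (by simp), ← fermatForm_self]
      exact D.fermatForm_pos _ (hv 0 (by simp))
    have hF : ∀ s ∈ Icc (0 : ℝ) 1, D.fermat (x s) (velocity 𝓘(ℝ, E) x (Icc 0 1) s)
        = D.fermatShift (x s) (velocity 𝓘(ℝ, E) x (Icc 0 1) s) + Real.sqrt c := fun s hs => by
      rw [fermat_eq, fermatForm_self, hc s hs]
    -- Nothing is assumed about the regularity of `t` here. Since `√h(ẋ, ẋ)` is the constant `√c`,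
    -- the integrand is smooth, and hence so is `t`.
    have hFsmooth : ContDiffOn ℝ ∞
        (fun s => D.fermat (x s) (velocity 𝓘(ℝ, E) x (Icc 0 1) s)) (Icc 0 1) :=
      ContDiffOn.congr (fun s hs => (D.contDiffWithinAt_fermatShift_velocity hx hS hs).add
        contDiffWithinAt_const) hF
    have hderiv := fun s hs =>
      hasDerivWithinAt_of_eq_integral zero_le_one hFsmooth.continuousOn hint (s := s) hs
    have ht := contDiffOn_infty_of_hasDerivWithinAt hS hFsmooth hderiv
    have hℓ : ∀ s ∈ Icc (0 : ℝ) 1, derivWithin t (Icc 0 1) s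
        - D.fermatShift (x s) (velocity 𝓘(ℝ, E) x (Icc 0 1) s) = Real.sqrt c := fun s hs => by
      rw [(hderiv s hs).derivWithin (hS s hs), hF s hs]
      ring
    refine ⟨⟨⟨hx.prodMk ht.contMDiffOn, fun s hs => ?_⟩, fun s hs => ⟨fun h0 => ?_, ?_⟩⟩,
      fun s hs => ?_⟩
    · rw [D.leviCivitaAlong_eq_zero_iff hx hS hs ht, hℓ s hs]
      exact ⟨(hasDerivWithinAt_const s _ _).congr hℓ (hℓ s hs),
        (D.chernAlong_fermat_eq_zero_iff hx hS hs hv hc).1 (hgeo s hs)⟩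
    -- A vanishing `ż` would force its spatial component `ẋ` to vanish.
    · exact hv s hs (congrArg Prod.fst ((velocity_prodMk hx hS hs ht).symm.trans h0))
    · rw [D.normalizedMetric_velocity_self hx hS hs ht, hℓ s hs, hc s hs, Real.sq_sqrt hcpos.le,
        sub_self]
    · rw [D.normalizedMetric_velocity_timeField hx hS hs ht, hℓ s hs]
      exact neg_lt_zero.2 (Real.sqrt_pos.2 hcpos)
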